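/- **Setting.** Let $G=(V,E)$ be a finite simple graph on $n\ge 1$ vertices, $d(v)$ the degree of $v$, and $w$ a weight function on pairs of vertices with $w=1$ on nonedges and $w\in[1,W]$ on edges ($w\equiv1$ is the unweighted case). For $S\subseteq V$ let $d(v,S)$ be the number, and $d_w(v,S)$ the total weight, of the edges from $v$ to $S$; $d_w(v)=d_w(v,V)$. A clustering $\mathcal C$ is a partition of $V$; $C(v)$ is the cluster of $v$, and $\mathrm{Cost}_w(\mathcal C)$ is the weight of the edges between different clusters plus the weight of the nonedges inside clusters. $\mathcal C+C$ is obtained from $\mathcal C$ by removing the members of $C$ from their clusters and adding $C$ as a new cluster. *Preclustering.* A preclustered instance $(\mathcal K,E_{adm})$ consists of disjoint nonempty sets $K\in\mathcal K$ (atoms) and a set $E_{adm}$ of admissible pairs, each with at least one endpoint outside all atoms; $d^{adm}(v)$ is the number of admissible pairs at $v$. It is $\varepsilon$-good (with constant $A$) if $d^{adm}(v)\le 2\varepsilon^{-3}d(v)$ for all $v$, $d(u)\le2\varepsilon^{-1}d(v)$ for all admissible $uv$, and every vertex $v$ of an atom $K$ is adjacent to at least $(1-A\varepsilon)|K|$ vertices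 of $K$ (counting $v$ itself) and to at most $A\varepsilon|K|$ vertices outside $K$. A cluster $C$ is $\varepsilon$-good if it contains every atom it meets, any two distinct vertices of $C$ lie in a common atom or form an admissible pair, and $|C|\ge\varepsilon d(v)$ for all $v\in C$ unless $|C|=1$; a clustering is $\varepsilon$-good if all its clusters are. For an $\varepsilon$-good clustering $\mathrm{Opt}$, let $\mathrm{Opt}'$ be obtained by splitting every cluster $C$ that contains an atom $K$ with $|K|/|C|<\varepsilon^{21}/576$ into $K$ and $C\setminus K$. A clustering $\mathcal C$ is a $\gamma$-good local optimum with respect to $\mathrm{Opt}'$ if $\sum_{C\in\mathrm{Opt}'}(\mathrm{Cost}_w(\mathcal C)-\mathrm{Cost}_w(\mathcal C+C))\le2\gamma|E_{adm}|$. *Neighborhoods.* $N_v$ is $v$ with all vertices admissible to $v$. If $v$ is in no atom, $K(v)=\{v\}$ and $N(v)=N_v\setminus\bigcup_{K\in\mathcal K}K$; if $v$ is in the atom $K$, $K(v)=K$ and $N(v)=K\cup\bigcap_{u\in K}N_u$. $D(v)=N(v)\setminus K(v)$. *GenerateCluster.* For a sequence $S=(u_1,\dots,u_{\eta_0})$ of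 vertices and a real $s$, $$\mathrm{EstCostStays}(S,s,v)=d_w(v)-d_w(v,C(v))+|C(v)|-d(v,C(v))-1+\tfrac s{\eta_0}\sum_{j:\,u_j\in C(v)}\big(d_w(v,\{u_j\})+d(v,\{u_j\})-1\big),$$ $$\mathrm{EstCostMoves}(S,s,v)=d_w(v)+s-1-\tfrac s{\eta_0}\sum_j\big(d_w(v,\{u_j\})+d(v,\{u_j\})\big).$$ Let $D(r)$ be partitioned into $\eta$ batches $D_r^1,\dots,D_r^\eta$ whose sizes differ by at most one; the partition is arbitrary but depends only on $\mathcal C$ and $r$. $\mathrm{GenerateCluster}(\mathcal C,r,S^1,\dots,S^\eta,s^1,\dots,s^\eta)$ returns $K(r)$ together with all $v\in D_r^i$, $1\le i\le\eta$, for which $\mathrm{EstCostStays}(S^i,s^i,v)>\mathrm{EstCostMoves}(S^i,s^i,v)+6\eta^{-1}W|N(r)|$. *Faster-Local-Search* (parameters $\eta,\gamma,s$ and $\kappa,R$), run on $G,w$ and an $\varepsilon$-good preclustered instance. Start with $\mathcal C$ consisting of the atoms and of the other vertices as singletons, and perform rounds until $\mathcal C$ has not changed in $R$ consecutive rounds;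 then output $\mathcal C$. In a round: 1. sample $r'\in V$ uniformly and replace $\mathcal C$ by $\mathcal C+\{r'\}$ if this has smaller cost; 2. sample a pivot $r$, each $r$ with probability $\frac1{n\,d(r)}$ (and probability $0$ if $d(r)=0$), or finish the round with the remaining probability; 3. sample independent uniform subsets $T^1,\dots,T^\eta$ of $N(r)$ of size $\min(s,|N(r)|)$; 4. among all choices of multisets $S^i$ of $\eta^5$ vertices of $T^i$ and of sizes $s^i\in\{\varepsilon d(r)(1+\varepsilon')^k/2: k\in\mathbb Z,\ |k|\le\kappa\}$ with $\varepsilon'=1/\eta^2$, take one that minimizes the cost of $\mathcal C+\mathrm{GenerateCluster}(\mathcal C,r,S^1,\dots,S^\eta,s^1,\dots,s^\eta)$, and replace $\mathcal C$ by this clustering if its cost is at least $\gamma|E_{adm}|/n$ less than that of $\mathcal C$. **Theorem.** For every $A$, all sufficiently small $\varepsilon>0$ (depending on $A$), all $0<\gamma<\varepsilon^{13}/4$ and $W\ge1$, all sufficiently large integers $\eta$ (depending on $A,\varepsilon,\gamma,W$), all sufficiently large $s$ and $\kappa$ (depending also on $\eta$), and every integer $a\ge0$, there is a constant $c>0$,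 depending only on these parameters, such that the following holds for every $n\ge1$, every $G,w$ on $n$ vertices, every preclustered instance that is $\varepsilon$-good with constant $A$, every rule for the batches, every $R\ge c\,n\log n$, and every $\varepsilon$-good clustering $\mathrm{Opt}$ (in particular a cheapest one): Faster-Local-Search always halts after finitely many rounds, and with probability at least $1-n^{-a}$ the clustering it returns is a $\frac32\gamma$-good local optimum with respect to $\mathrm{Opt}'$. -/

import Mathlib

open scoped Classical

noncomputable section

namespace CorrClust

universe u

/-- A clustering scheme: a partition of the vertex set into nonempty clusters. -/
abbrev Clustering (V : Type u) [Fintype V] := Finpartition (Finset.univ : Finset V)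

/-- A preclustered instance: a family of pairwise disjoint (nonempty) atoms together with a set of
admissible pairs (represented as the edges of a graph), each admissible pair having at least one
endpoint outside all atoms. -/
structure Preclustering (V : Type u) where
  atoms : Finset (Finset V)
  adm : SimpleGraph V
  atom_nonempty : ∀ K ∈ atoms, K.Nonempty
  atom_disjoint : ∀ K ∈ atoms, ∀ L ∈ atoms, K ≠ L → Disjoint K L
  adm_not_both : ∀ u v, adm.Adj u v →
    ¬ ((∃ K ∈ atoms, u ∈ K) ∧ (∃ K ∈ atoms, v ∈ K))

section Graph

variable {V : Type u} [Fintype V] (G : SimpleGraph V) (w : Sym2 V → ℝ)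

/-- Both endpoints of the pair lie in one cluster. -/
def Inside (𝒞 : Clustering V) (e : Sym2 V) : Prop :=
  ∃ C ∈ 𝒞.parts, ∀ v ∈ e, v ∈ C

/-- The weight of the edges cut by `𝒞` plus the weight of the nonedges inside its clusters. -/
def cost (𝒞 : Clustering V) : ℝ :=
  (∑ e ∈ G.edgeFinset.filter (fun e => ¬ Inside 𝒞 e), w e) +
    ∑ e ∈ Gᶜ.edgeFinset.filter (fun e => Inside 𝒞 e), w e

/-- Nonedges have weight `1` and edges have weights in `[1, W]`. -/
def IsWeight (W : ℝ) : Prop :=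
  (∀ e ∈ G.edgeSet, 1 ≤ w e ∧ w e ≤ W) ∧ ∀ e ∈ Gᶜ.edgeSet, w e = 1

/-- `𝒞 + C`: the members of `C` leave their clusters and `C` becomes a new cluster
(nothing happens for `C = ∅`). -/
def addCluster (𝒞 : Clustering V) (C : Finset V) : Clustering V :=
  (𝒞.avoid C).extendOfLE (Finset.sdiff_subset)

/-- `d(v, S)`. -/
def degIn (v : V) (S : Finset V) : ℝ := ((S.filter (fun u => G.Adj v u)).card : ℝ)

/-- `d_w(v, S)`. -/
def wdegIn (v : V) (S : Finset V) : ℝ := ∑ u ∈ S.filter (fun u => G.Adj v u), w s(v, u)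

/-- `d_w(v)`. -/
def wdeg (v : V) : ℝ := wdegIn G w v Finset.univ

/-- `EstCostStays(S, s, v)` for a sequence `S` of `η₀` sampled vertices and a size guess `s`. -/
def estCostStays (𝒞 : Clustering V) {η₀ : ℕ} (S : Fin η₀ → V) (s : ℝ) (v : V) : ℝ :=
  wdeg G w v - wdegIn G w v (𝒞.part v) + ((𝒞.part v).card : ℝ) - degIn G v (𝒞.part v) - 1 +
    s / η₀ * ∑ j, if S j ∈ 𝒞.part v then wdegIn G w v {S j} + degIn G v {S j} - 1 else 0

/-- `EstCostMoves(S, s, v)`. -/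
def estCostMoves {η₀ : ℕ} (S : Fin η₀ → V) (s : ℝ) (v : V) : ℝ :=
  wdeg G w v + s - 1 - s / η₀ * ∑ j, (wdegIn G w v {S j} + degIn G v {S j})

end Graph

namespace Preclustering

variable {V : Type u} [Fintype V] (P : Preclustering V)

/-- `v ∈ V_𝒦`. -/
def InAtom (v : V) : Prop := ∃ K ∈ P.atoms, v ∈ K

/-- `u` and `v` lie in a common atom. -/
def SameAtom (u v : V) : Prop := ∃ K ∈ P.atoms, u ∈ K ∧ v ∈ K

/-- `d^adm(C) = ∑_{u ∈ C} d^adm(u)`. -/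
def admDeg (C : Finset V) : ℕ := ∑ u ∈ C, P.adm.degree u

/-- `|E_adm|`. -/
def numAdm : ℕ := P.adm.edgeFinset.card

/-- `ε`-good preclustered instances, with `A` the constant of the two `O(ε)` terms. In the fraction
of an atom adjacent to `v`, the vertex `v` itself counts as adjacent. -/
def IsGood (G : SimpleGraph V) (A ε : ℝ) : Prop :=
  (∀ v, (P.adm.degree v : ℝ) ≤ 2 * (ε ^ 3)⁻¹ * G.degree v) ∧
  (∀ u v, P.adm.Adj u v → (G.degree u : ℝ) ≤ 2 * ε⁻¹ * G.degree v) ∧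
  ∀ K ∈ P.atoms, ∀ v ∈ K,
    (1 - A * ε) * (K.card : ℝ) ≤ degIn G v K + 1 ∧
    degIn G v (Finset.univ \ K) ≤ A * ε * (K.card : ℝ)

/-- `δ`-good clusters: they break no atom, contain no non-admissible pair, and, unless they are
singletons, have size at least `δ d(v)` for each member `v`. -/
def IsGoodCluster (G : SimpleGraph V) (δ : ℝ) (C : Finset V) : Prop :=
  (∀ u ∈ C, ∀ v, P.SameAtom u v → v ∈ C) ∧
  (∀ u ∈ C, ∀ v ∈ C, u ≠ v → P.SameAtom u v ∨ P.adm.Adj u v) ∧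
  ∀ v ∈ C, 1 < C.card → δ * G.degree v ≤ (C.card : ℝ)

def IsGoodClustering (G : SimpleGraph V) (δ : ℝ) (𝒞 : Clustering V) : Prop :=
  ∀ C ∈ 𝒞.parts, P.IsGoodCluster G δ C

/-- `N_v`: the vertex `v` and all vertices admissible to it. -/
def admNbhd (v : V) : Finset V := Finset.univ.filter (fun u => u = v ∨ P.adm.Adj v u)

/-- `K(v)`: the atom of `v`, or `{v}` if `v` is in no atom. -/
def K (v : V) : Finset V := Finset.univ.filter (fun u => u = v ∨ P.SameAtom v u)

/-- `N(v)`: for `v` in no atom, `N_v` without the vertices of atoms; for `v` in an atom `K`,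
the set `K ∪ ⋂_{u ∈ K} N_u`. -/
def N (v : V) : Finset V :=
  if P.InAtom v then
    P.K v ∪ Finset.univ.filter (fun x => ∀ u ∈ P.K v, x ∈ P.admNbhd u)
  else (P.admNbhd v).filter (fun x => ¬ P.InAtom x)

/-- `D(v) = N(v) ∖ K(v)`. -/
def D (v : V) : Finset V := P.N v \ P.K v

theorem self_mem_N (v : V) : v ∈ P.N v := by
  unfold N
  split_ifs with h
  · simp [K]
  · simp [admNbhd, h]

/-- The atoms, and the vertices outside atoms as singletons. -/
def initial : Clustering V :=
  Finpartition.ofExistsUnique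
    (P.atoms ∪ (Finset.univ.filter (fun v => ¬ P.InAtom v)).image (fun v => {v}))
    (fun _ _ => Finset.subset_univ _)
    (by
      intro a _
      by_cases ha : P.InAtom a
      · obtain ⟨K, hK, haK⟩ := ha
        refine ⟨K, ⟨Finset.mem_union_left _ hK, haK⟩, ?_⟩
        rintro L ⟨hL, haL⟩
        rcases Finset.mem_union.1 hL with hL | hL
        · by_contra hne
          exact Finset.disjoint_left.1 (P.atom_disjoint L hL K hK hne) haL haK
        · obtain ⟨v, hv, rfl⟩ := Finset.mem_image.1 hL
          rw [Finset.mem_singleton] at haL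
          subst haL
          exact absurd ⟨K, hK, haK⟩ (Finset.mem_filter.1 hv).2
      · refine ⟨{a}, ⟨Finset.mem_union_right _ (Finset.mem_image.2 ⟨a, ?_, rfl⟩),
          Finset.mem_singleton_self a⟩, ?_⟩
        · simpa using ha
        · rintro L ⟨hL, haL⟩
          rcases Finset.mem_union.1 hL with hL | hL
          · exact absurd ⟨L, hL, haL⟩ ha
          · obtain ⟨v, hv, rfl⟩ := Finset.mem_image.1 hL
            rw [Finset.mem_singleton] at haL
            subst haL
            rfl)
    (by
      intro h
      rcases Finset.mem_union.1 h with h | h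
      · exact absurd (P.atom_nonempty _ h) (by simp)
      · obtain ⟨v, _, hv⟩ := Finset.mem_image.1 h
        exact absurd hv (Finset.singleton_ne_empty v))

/-- The split clustering: every cluster `C` that contains an atom `K` with
`|K| / |C| < ε ^ 21 / 576` is replaced by the two clusters `K` and `C ∖ K`. (A good cluster
contains at most one atom.) -/
def split (ε : ℝ) (Opt : Clustering V) : Clustering V :=
  Opt.bind fun C hC =>
    if h : ∃ K ∈ P.atoms, K ⊆ C ∧ (K.card : ℝ) < ε ^ 21 / 576 * (C.card : ℝ) then
      (Finpartition.indiscrete (a := h.choose)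
        (P.atom_nonempty _ h.choose_spec.1).ne_empty).extendOfLE h.choose_spec.2.1
    else Finpartition.indiscrete (Opt.ne_bot hC)

/-- `𝒞` is a `γ`-good local optimum with respect to the clustering `𝒪`:
`∑_{C ∈ 𝒪} (Cost(𝒞) - Cost(𝒞 + C)) ≤ 2 γ |E_adm|`. -/
def IsGoodLocalOpt (G : SimpleGraph V) (w : Sym2 V → ℝ) (γ : ℝ) (𝒪 𝒞 : Clustering V) : Prop :=
  ∑ C ∈ 𝒪.parts, (cost G w 𝒞 - cost G w (addCluster 𝒞 C)) ≤ 2 * γ * P.numAdm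

end Preclustering

/-- Parameters of the local search: accuracy `ε`, threshold `γ`, weight bound `W`, number of batches
`η`, sample size `s`, half-length `κ` of the list of size guesses, and number `R` of consecutive
rounds without change after which the search stops. -/
structure Params where
  ε : ℝ
  γ : ℝ
  W : ℝ
  η : ℕ
  s : ℕ
  κ : ℕ
  R : ℕ

section Algorithm

variable {V : Type u} [Fintype V] (G : SimpleGraph V) (w : Sym2 V → ℝ) (P : Preclustering V)
  (p : Params)

/-- A rule which, given the current clustering and a pivot `r`, distributes the vertices of `D(r)`
over `η` batches of equal size (up to one vertex). -/
def IsBatching {η : ℕ} (batch : Clustering V → V → V → Fin η) : Prop :=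
  ∀ 𝒞 r i j, ((P.D r).filter (fun v => batch 𝒞 r v = i)).card ≤
    ((P.D r).filter (fun v => batch 𝒞 r v = j)).card + 1

variable (batch : Clustering V → V → V → Fin p.η)

/-- The `k`-th size guess `ε d(r) (1 + ε')^k / 2`, with `ε' = 1 / η²`. -/
def sizeGuess (r : V) (k : ℤ) : ℝ :=
  p.ε * G.degree r / 2 * (1 + 1 / (p.η : ℝ) ^ 2) ^ k

/-- `GenerateCluster`. Membership of `v` in the output depends only on the current clustering `𝒞`
and on the sample and size guess of the batch of `v`, so the loop over the batches is written as a
single set. -/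
def generateCluster (𝒞 : Clustering V) (r : V) (S : Fin p.η → Fin (p.η ^ 5) → V)
    (s : Fin p.η → ℝ) : Finset V :=
  P.K r ∪ (P.D r).filter (fun v =>
    estCostMoves G w (S (batch 𝒞 r v)) (s (batch 𝒞 r v)) v
        + 6 * (p.η : ℝ)⁻¹ * p.W * ((P.N r).card : ℝ)
      < estCostStays G w 𝒞 (S (batch 𝒞 r v)) (s (batch 𝒞 r v)) v)

/-- All collections of `η` multisets (listed as sequences) of `η ^ 5` vertices of `T^1, …, T^η`, with
all collections of `η` size guesses (given by their exponents). -/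
def candidates (T : Fin p.η → Finset V) :
    Finset ((Fin p.η → Fin (p.η ^ 5) → V) × (Fin p.η → ℤ)) :=
  (Fintype.piFinset fun i => Fintype.piFinset fun _ => T i) ×ˢ
    (Fintype.piFinset fun _ => Finset.Icc (-(p.κ : ℤ)) (p.κ : ℤ))

/-- `𝒞 + GenerateCluster(…)` for one candidate. -/
def tryCandidate (𝒞 : Clustering V) (r : V)
    (x : (Fin p.η → Fin (p.η ^ 5) → V) × (Fin p.η → ℤ)) : Clustering V :=
  addCluster 𝒞 (generateCluster G w P p batch 𝒞 r x.1 (fun i => sizeGuess G p r (x.2 i)))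

/-- Take a candidate of minimum cost and accept it if it improves by at least `γ |E_adm| / n`. -/
def pivotStep (𝒞 : Clustering V) (r : V) (T : Fin p.η → Finset V) : Clustering V :=
  if h : (candidates p T).Nonempty then
    let best := tryCandidate G w P p batch 𝒞 r
      (Finset.exists_min_image (candidates p T)
        (fun x => cost G w (tryCandidate G w P p batch 𝒞 r x)) h).choose
    if cost G w best ≤ cost G w 𝒞 - p.γ * P.numAdm / Fintype.card V then best else 𝒞
  else 𝒞

/-- Try to improve the clustering by the singleton `{r'}`. -/
def singletonStep (𝒞 : Clustering V) (r' : V) : Clustering V :=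
  if cost G w (addCluster 𝒞 {r'}) < cost G w 𝒞 then addCluster 𝒞 {r'} else 𝒞

/-- Probability `1 / (n d(r))`; vertices of degree `0` are never pivots (here `1 / 0 = 0`). -/
def pivotProb (r : V) : ENNReal :=
  ENNReal.ofReal (1 / ((Fintype.card V : ℝ) * G.degree r))

theorem sum_pivotProb_le : ∑ r, pivotProb G r ≤ 1 := by
  unfold pivotProb
  rw [← ENNReal.ofReal_sum_of_nonneg (fun _ _ => by positivity)]
  apply ENNReal.ofReal_le_one.2
  have h : ∀ r ∈ (Finset.univ : Finset V),
      1 / ((Fintype.card V : ℝ) * G.degree r) ≤ 1 / (Fintype.card V : ℝ) := by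
    intro r _
    have hn : (0 : ℝ) < Fintype.card V := by
      exact_mod_cast Fintype.card_pos_iff.2 ⟨r⟩
    rcases Nat.eq_zero_or_pos (G.degree r) with hd | hd
    · rw [hd]; simp
    · have hd' : (1 : ℝ) ≤ G.degree r := by exact_mod_cast hd
      exact one_div_le_one_div_of_le hn (le_mul_of_one_le_right hn.le hd')
  refine (Finset.sum_le_sum h).trans ?_
  rw [Finset.sum_const, nsmul_eq_mul, Finset.card_univ, mul_one_div]
  exact div_self_le_one _

/-- The pivot: `some r` with probability `1 / (n d(r))`, otherwise `none`. -/
def pivotLaw : PMF (Option V) :=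
  PMF.ofFintype (fun o => o.elim (1 - ∑ r, pivotProb G r) (pivotProb G)) (by
    rw [Fintype.sum_option]
    exact tsub_add_cancel_of_le (sum_pivotProb_le G))

/-- `η` independent uniform subsets of `N(r)` of size `s` (all of `N(r)` if it has fewer than `s`
vertices). -/
def subsetLaw (r : V) : PMF (Fin p.η → Finset V) :=
  PMF.uniformOfFinset
    (Fintype.piFinset fun _ : Fin p.η => (P.N r).powersetCard (min p.s (P.N r).card))
    (Fintype.piFinset_nonempty.2 fun _ => Finset.powersetCard_nonempty.2 (min_le_right _ _))

/-- The random clustering after one round started in `𝒞`. -/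
def round [Nonempty V] (𝒞 : Clustering V) : PMF (Clustering V) :=
  (PMF.uniformOfFintype V).bind fun r' =>
    (pivotLaw G).bind fun o =>
      match o with
      | none => PMF.pure (singletonStep G w 𝒞 r')
      | some r => (subsetLaw P p r).map fun T =>
          pivotStep G w P p batch (singletonStep G w 𝒞 r') r T

/-- One round of the search on states `(𝒞, k)`, where `k` is the number of consecutive rounds in
which `𝒞` did not change; the search has halted once `k ≥ R`. -/
def step [Nonempty V] (σ : Clustering V × ℕ) : PMF (Clustering V × ℕ) :=
  if p.R ≤ σ.2 then PMF.pure σ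
  else (round G w P p batch σ.1).map fun 𝒞' => if 𝒞' = σ.1 then (𝒞', σ.2 + 1) else (𝒞', 0)

/-- The law of the state of the search after `t` rounds. -/
def law [Nonempty V] : ℕ → PMF (Clustering V × ℕ)
  | 0 => PMF.pure (P.initial, 0)
  | t + 1 => (law t).bind (step G w P p batch)

end Algorithm

end CorrClust

end

noncomputable section

namespace CorrClust

universe u

/-! ### Counting samples: second moments, subsets containing a sample, successive batches -/

section Counting

/-! Two facts carry the theorem. A clustering that is not a `3γ/2`-good local optimum changes in a
round with probability at least `q/n`, where `q > 0` depends only on the parameters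
(`round_apply_self_le`). And the number of changes is at most polynomial in `n`, since an integer
rank drops at every change (`isRank_costRank`, `costRank_le`). With `x = 1 - q/n`, the potential `[𝒞
bad] x^(R-k) + μ(𝒞) x^R` of a state `(𝒞, k)` is a supermartingale (`expect_step_le`), so the search
ends in a bad clustering with probability at most `(1 + μ) x^R`. This is at most `n^(-a)` once `R ≥
c n log n`.

For the first fact, averaging over the clusters of the split optimum gives a cluster `C` such that
adding it saves at least `γ d^adm(C) + γ|E_adm|/n` (`exists_improving_cluster`). If some singleton
improves `𝒞`, it is drawn with probability `1/n`; this covers a singleton `C`. Otherwise a set `Q`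
of pivots in `C`, hit with probability at least `ε/(2n)`, satisfies `K(r) ⊆ C ⊆ N(r)` and
`|D(r)||N(r)| ≤ 100 ε^(-8) d^adm(C)` (`exists_pivots`). It then suffices that with constant
probability some candidate costs at most `13W|D(r)||N(r)|/η` more than `𝒞 + C`
(`sampleRate_mul_card_le`): for large `η` this loss is below `γ d^adm(C)`, and the candidate is
accepted.

The candidate is analysed by a hybrid argument: start with `X = C` and replace membership in `X` by
the decisions of the algorithm, one batch at a time. The gain from moving `v` into the new cluster
is a sum over `X`, up to terms inside the batch, and sampling from `X` estimates it. The algorithm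
does not know `X`, but a sequence of `η^5` vertices of `N(r)` lies in `X` with probability at least
`η^(-η^5)` if `X` is not too small, and Chebyshev makes half of these sequences accurate on average
over the batch (`exists_guess_card_filter_sample`, `exists_guess_card_filter_batch`). Multiplying
over the batches (`pow_mul_card_le_card_sequences`) and passing from sequences to the random sets
`T^i` by double counting (`card_mul_le_card_subsets_containing`) leaves a constant success
probability.

If there are no admissible pairs, the improvement threshold is `0` and the rank is not available; in
that case the initial clustering never changes and is already locally optimal. -/

theorem sum_piFinset_cons {τ : Type*} (Y : Finset τ) (n : ℕ) (F : (Fin (n + 1) → τ) → ℝ) :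
    ∑ S ∈ Fintype.piFinset (fun _ : Fin (n + 1) => Y), F S =
      ∑ z ∈ Y, ∑ S ∈ Fintype.piFinset (fun _ : Fin n => Y), F (Fin.cons z S) := by
  rw [← Finset.sum_product']
  symm
  refine Finset.sum_bij' (fun x _ => Fin.cons x.1 x.2) (fun S _ => (S 0, Fin.tail S)) ?_ ?_ ?_ ?_ ?_
  · rintro ⟨z, S⟩ hx
    simp only [Finset.mem_product, Fintype.mem_piFinset] at hx ⊢
    intro i
    refine Fin.cases ?_ (fun j => ?_) i
    · simpa using hx.1
    · simpa using hx.2 j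
  · intro S hS
    simp only [Finset.mem_product, Fintype.mem_piFinset] at hS ⊢
    exact ⟨hS 0, fun i => hS _⟩
  · rintro ⟨z, S⟩ _
    simp
  · intro S _
    simp
  · rintro ⟨z, S⟩ _
    rfl

theorem sum_piFinset_sum_eq_zero {τ : Type*} (Y : Finset τ) (f : τ → ℝ) (hf : ∑ z ∈ Y, f z = 0)
    (n : ℕ) : ∑ S ∈ Fintype.piFinset (fun _ : Fin n => Y), ∑ j, f (S j) = 0 := by
  induction n with
  | zero => simp
  | succ n ih =>
    rw [sum_piFinset_cons]
    simp only [Fin.sum_univ_succ, Fin.cons_zero, Fin.cons_succ, Finset.sum_add_distrib, ih,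
      Finset.sum_const, nsmul_eq_mul]
    rw [← Finset.mul_sum, hf]
    simp

/-- Second moment of the sum of independent uniform samples of a function of mean zero. -/
theorem sum_piFinset_sq_sum {τ : Type*} (Y : Finset τ) (f : τ → ℝ) (hf : ∑ z ∈ Y, f z = 0)
    (n : ℕ) : (Y.card : ℝ) * ∑ S ∈ Fintype.piFinset (fun _ : Fin n => Y), (∑ j, f (S j)) ^ 2 =
      n * (Y.card : ℝ) ^ n * ∑ z ∈ Y, f z ^ 2 := by
  induction n with
  | zero => simp
  | succ n ih =>
    rw [sum_piFinset_cons]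
    have h : ∀ z ∈ Y, ∑ S ∈ Fintype.piFinset (fun _ : Fin n => Y),
        (∑ j, f ((Fin.cons z S : Fin (n + 1) → τ) j)) ^ 2 =
        (Y.card : ℝ) ^ n * f z ^ 2 +
          ∑ S ∈ Fintype.piFinset (fun _ : Fin n => Y), (∑ j, f (S j)) ^ 2 := by
      intro z _
      have h0 := sum_piFinset_sum_eq_zero Y f hf n
      calc _ = ∑ S ∈ Fintype.piFinset (fun _ : Fin n => Y),
            (f z ^ 2 + 2 * f z * ∑ j, f (S j) + (∑ j, f (S j)) ^ 2) := by
            refine Finset.sum_congr rfl fun S _ => ?_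
            simp only [Fin.sum_univ_succ, Fin.cons_zero, Fin.cons_succ]
            ring
        _ = _ := by
            rw [Finset.sum_add_distrib, Finset.sum_add_distrib, ← Finset.mul_sum, h0]
            simp
    rw [Finset.sum_congr rfl h, Finset.sum_add_distrib, ← Finset.mul_sum, Finset.sum_const,
      nsmul_eq_mul, mul_add, ih]
    push_cast
    ring

/-- Chebyshev's inequality for samples with replacement, simultaneously for several functions. -/
theorem half_le_card_filter_sample {V : Type*} (Z : Finset V) {h : ℕ} (hh : 0 < h)
    (B : Finset V) (ψ : V → V → ℝ) {M t : ℝ} (ht : 0 < t) (hM : 0 < M)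
    (hψ : ∀ v u, |ψ v u| ≤ M) (hth : 2 ≤ h * t ^ 2) :
    (Z.card : ℝ) ^ h / 2 ≤
      (((Fintype.piFinset (fun _ : Fin h => Z)).filter (fun S =>
        ∑ v ∈ B, |(Z.card : ℝ) / h * ∑ j, ψ v (S j) - ∑ u ∈ Z, ψ v u| ≤
          B.card * (Z.card * M * t))).card : ℝ) := by
  rcases Z.eq_empty_or_nonempty with rfl | hZ
  · simp [hh.ne']
  rcases B.eq_empty_or_nonempty with rfl | hB
  · simp
  have hz : (0 : ℝ) < Z.card := by exact_mod_cast hZ.card_pos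
  have hb : (0 : ℝ) < B.card := by exact_mod_cast hB.card_pos
  have hh' : (0 : ℝ) < h := by exact_mod_cast hh
  set z : ℝ := (Z.card : ℝ)
  set b : ℝ := (B.card : ℝ)
  set Ω := Fintype.piFinset (fun _ : Fin h => Z)
  set e : V → (Fin h → V) → ℝ := fun v S => z / h * ∑ j, ψ v (S j) - ∑ u ∈ Z, ψ v u with he
  have hΩ : (Ω.card : ℝ) = z ^ h := by simp [Ω, z]
  have hvar : ∀ v, ∑ S ∈ Ω, e v S ^ 2 ≤ z ^ h * z ^ 2 * M ^ 2 / h := by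
    intro v
    set m : ℝ := (∑ u ∈ Z, ψ v u) / z with hm
    set f : V → ℝ := fun u => ψ v u - m with hf
    have hmz : z * m = ∑ u ∈ Z, ψ v u := by rw [hm]; field_simp
    have hf0 : ∑ u ∈ Z, f u = 0 := by
      simp only [hf, Finset.sum_sub_distrib, Finset.sum_const, nsmul_eq_mul]
      linarith
    have hfe : ∀ S, e v S = z / h * ∑ j, f (S j) := by
      intro S
      simp only [he, hf, Finset.sum_sub_distrib, Finset.sum_const, nsmul_eq_mul,
        Finset.card_univ, Fintype.card_fin]
      rw [← hmz]
      field_simp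
    have hf2 : ∑ u ∈ Z, f u ^ 2 ≤ z * M ^ 2 := by
      have h1 : ∑ u ∈ Z, f u ^ 2 = ∑ u ∈ Z, ψ v u ^ 2 - z * m ^ 2 := by
        have : ∀ u ∈ Z, f u ^ 2 = ψ v u ^ 2 - 2 * m * ψ v u + m ^ 2 := by
          intro u _
          simp only [hf]
          ring
        rw [Finset.sum_congr rfl this, Finset.sum_add_distrib, Finset.sum_sub_distrib,
          ← Finset.mul_sum, ← hmz, Finset.sum_const, nsmul_eq_mul]
        change _ - 2 * m * (z * m) + z * m ^ 2 = _
        ring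
      have h2 : ∑ u ∈ Z, ψ v u ^ 2 ≤ ∑ u ∈ Z, M ^ 2 :=
        Finset.sum_le_sum fun u _ => sq_le_sq' (abs_le.1 (hψ v u)).1 (abs_le.1 (hψ v u)).2
      rw [Finset.sum_const, nsmul_eq_mul] at h2
      have : 0 ≤ z * m ^ 2 := by positivity
      linarith
    have hsq := sum_piFinset_sq_sum Z f hf0 h
    have hval : ∑ S ∈ Ω, (∑ j, f (S j)) ^ 2 = h * z ^ h * (∑ u ∈ Z, f u ^ 2) / z := by
      rw [eq_div_iff hz.ne', mul_comm]
      exact hsq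
    calc ∑ S ∈ Ω, e v S ^ 2 = (z / h) ^ 2 * ∑ S ∈ Ω, (∑ j, f (S j)) ^ 2 := by
          rw [Finset.mul_sum]
          refine Finset.sum_congr rfl fun S _ => ?_
          rw [hfe]
          ring
      _ = z ^ h * z / h * ∑ u ∈ Z, f u ^ 2 := by
          rw [hval]
          field_simp
      _ ≤ z ^ h * z / h * (z * M ^ 2) := by gcongr
      _ = _ := by ring
  set good := Ω.filter (fun S => ∑ v ∈ B, |e v S| ≤ b * (z * M * t))
  set bad := Ω.filter (fun S => ¬ ∑ v ∈ B, |e v S| ≤ b * (z * M * t))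
  have hsplit : (good.card : ℝ) + bad.card = z ^ h := by
    rw [← hΩ]
    exact_mod_cast Finset.card_filter_add_card_filter_not (s := Ω) _
  -- Cauchy–Schwarz turns the error summed over `B` into a second moment, so one application of
  -- Markov's inequality treats all of `B` without a union bound over its vertices.
  have hbad : (bad.card : ℝ) * (b * (z * M * t)) ^ 2 ≤ b * (b * (z ^ h * z ^ 2 * M ^ 2 / h)) := by
    calc (bad.card : ℝ) * (b * (z * M * t)) ^ 2 = ∑ S ∈ bad, (b * (z * M * t)) ^ 2 := by simp
      _ ≤ ∑ S ∈ bad, b * ∑ v ∈ B, e v S ^ 2 := by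
          refine Finset.sum_le_sum fun S hS => ?_
          have h1 := (Finset.mem_filter.1 hS).2
          push Not at h1
          have h2 : (b * (z * M * t)) ^ 2 ≤ (∑ v ∈ B, |e v S|) ^ 2 :=
            pow_le_pow_left₀ (by positivity) h1.le 2
          have h3 := sq_sum_le_card_mul_sum_sq (s := B) (f := fun v => |e v S|)
          simp only [sq_abs] at h3
          exact h2.trans h3
      _ ≤ ∑ S ∈ Ω, b * ∑ v ∈ B, e v S ^ 2 :=
          Finset.sum_le_sum_of_subset_of_nonneg (Finset.filter_subset _ _)
            fun S _ _ => by positivity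
      _ = b * ∑ v ∈ B, ∑ S ∈ Ω, e v S ^ 2 := by
          rw [← Finset.mul_sum, Finset.sum_comm]
      _ ≤ b * ∑ v ∈ B, z ^ h * z ^ 2 * M ^ 2 / h := by
          gcongr with v _
          exact hvar v
      _ = _ := by simp [b]
  have hbad' : (bad.card : ℝ) ≤ z ^ h / 2 := by
    have hpos : 0 < b ^ 2 * z ^ 2 * M ^ 2 / h := by positivity
    have h1 : (bad.card : ℝ) * (h * t ^ 2) * (b ^ 2 * z ^ 2 * M ^ 2 / h) ≤
        z ^ h * (b ^ 2 * z ^ 2 * M ^ 2 / h) := by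
      refine le_trans (le_of_eq ?_) (hbad.trans (le_of_eq ?_))
      · field_simp
      · ring
    have h2 := le_of_mul_le_mul_right h1 hpos
    have h3 : (bad.card : ℝ) * 2 ≤ bad.card * (h * t ^ 2) := by gcongr
    linarith
  change z ^ h / 2 ≤ (good.card : ℝ)
  linarith

/-- The proportion of `m`-subsets containing a `j`-set is `C(m,j) / C(|N|,j)`. For `j ≤ h ≤ m/2`
every factor of the falling factorial of `m` is at least `m/2`, and for `m = |N|` the proportion is
`1`. -/
theorem le_card_powersetCard_filter_superset {V : Type*} {N U : Finset V} {m h : ℕ} (hU : U ⊆ N)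
    (hUh : U.card ≤ h) (hmN : m ≤ N.card) (hm : 2 * h ≤ m ∨ m = N.card) :
    ((m : ℝ) / (2 * N.card)) ^ h * (N.card.choose m) ≤
      (((N.powersetCard m).filter (fun T => U ⊆ T)).card : ℝ) := by
  rcases N.eq_empty_or_nonempty with rfl | hN
  · have hm0 : m = 0 := by simpa using hmN
    have hU0 : U = ∅ := Finset.subset_empty.1 hU
    subst hm0 hU0
    simp
    exact pow_le_one₀ le_rfl (by norm_num)
  have hNpos : (0 : ℝ) < N.card := by exact_mod_cast hN.card_pos
  have hratio : (m : ℝ) / (2 * N.card) ≤ 1 := by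
    rw [div_le_one (by positivity)]
    have : (m : ℝ) ≤ N.card := by exact_mod_cast hmN
    linarith
  set j := U.card with hj
  have hjm : j ≤ m := by
    rcases hm with hm | hm
    · omega
    · rw [hm]; exact Finset.card_le_card hU
  have hcount : (N.card - j).choose (m - j) ≤
      ((N.powersetCard m).filter (fun T => U ⊆ T)).card := by
    rw [hj, ← Finset.card_sdiff_of_subset hU, ← Finset.card_powersetCard]
    refine Finset.card_le_card_of_injOn (fun T => T ∪ U) ?_ ?_
    · intro T hT
      rw [Finset.mem_coe, Finset.mem_powersetCard] at hT
      have hd : Disjoint T U := Finset.disjoint_of_subset_left hT.1 Finset.sdiff_disjoint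
      rw [Finset.mem_coe, Finset.mem_filter, Finset.mem_powersetCard]
      refine ⟨⟨Finset.union_subset (hT.1.trans Finset.sdiff_subset) hU, ?_⟩,
        Finset.subset_union_right⟩
      rw [Finset.card_union_of_disjoint hd, hT.2]
      omega
    · intro T hT T' hT' heq
      rw [Finset.mem_coe, Finset.mem_powersetCard] at hT hT'
      have hd : Disjoint T U := Finset.disjoint_of_subset_left hT.1 Finset.sdiff_disjoint
      have hd' : Disjoint T' U := Finset.disjoint_of_subset_left hT'.1 Finset.sdiff_disjoint
      have h1 := congrArg (· \ U) heq
      simpa [Finset.union_sdiff_right, Finset.sdiff_eq_self_of_disjoint hd,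
        Finset.sdiff_eq_self_of_disjoint hd'] using h1
  have hmul : N.card.choose m * m.choose j = N.card.choose j * (N.card - j).choose (m - j) :=
    Nat.choose_mul hjm
  have hjN : j ≤ N.card := hjm.trans hmN
  have hkey : ((m : ℝ) / (2 * N.card)) ^ j * (N.card.choose j) ≤ m.choose j := by
    rcases hm with hm | hm
    · have h1 : ((m + 1 - j : ℕ) : ℝ) ^ j ≤ m.descFactorial j := by
        exact_mod_cast Nat.pow_sub_le_descFactorial m j
      have h2 : (N.card.descFactorial j : ℝ) ≤ (N.card : ℝ) ^ j := by
        exact_mod_cast Nat.descFactorial_le_pow N.card j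
      have h3 : (m : ℝ) / 2 ≤ ((m + 1 - j : ℕ) : ℝ) := by
        rw [div_le_iff₀ (by norm_num)]
        have : m ≤ (m + 1 - j) * 2 := by omega
        exact_mod_cast this
      have h4 : ((m : ℝ) / (2 * N.card)) ^ j * (N.card.descFactorial j) ≤ m.descFactorial j :=
        calc ((m : ℝ) / (2 * N.card)) ^ j * (N.card.descFactorial j)
            ≤ ((m : ℝ) / (2 * N.card)) ^ j * (N.card : ℝ) ^ j := by gcongr
          _ = ((m : ℝ) / 2) ^ j := by
              rw [← mul_pow]
              congr 1
              field_simp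
          _ ≤ ((m + 1 - j : ℕ) : ℝ) ^ j := by gcongr
          _ ≤ _ := h1
      rw [Nat.descFactorial_eq_factorial_mul_choose, Nat.descFactorial_eq_factorial_mul_choose] at h4
      push_cast at h4
      have h5 : (0 : ℝ) < (j.factorial : ℝ) := by exact_mod_cast j.factorial_pos
      refine le_of_mul_le_mul_left ?_ h5
      linarith
    · rw [hm] at hratio ⊢
      exact mul_le_of_le_one_left (by positivity) (pow_le_one₀ (by positivity) hratio)
  have hCj : (0 : ℝ) < N.card.choose j := by exact_mod_cast Nat.choose_pos hjN
  have hmul' : ((N.card.choose m : ℕ) : ℝ) * m.choose j =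
      N.card.choose j * ((N.card - j).choose (m - j) : ℕ) := by exact_mod_cast hmul
  calc ((m : ℝ) / (2 * N.card)) ^ h * (N.card.choose m)
      ≤ ((m : ℝ) / (2 * N.card)) ^ j * (N.card.choose m) := by
        exact mul_le_mul_of_nonneg_right (pow_le_pow_of_le_one (by positivity) hratio hUh)
          (by positivity)
    _ ≤ ((N.card - j).choose (m - j) : ℕ) := by
        refine le_of_mul_le_mul_left ?_ hCj
        rw [← hmul']
        calc _ = ((N.card.choose m : ℕ) : ℝ) * (((m : ℝ) / (2 * N.card)) ^ j * (N.card.choose j)) := by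
              ring
          _ ≤ _ := by gcongr
    _ ≤ _ := by exact_mod_cast hcount

/-- If a positive proportion of all sequences of vertices of `N` is favourable, then a positive
proportion of all sequences of `m`-subsets of `N` contains a favourable sequence. -/
theorem card_mul_le_card_subsets_containing {V : Type*} {η h : ℕ} {N : Finset V} {m : ℕ}
    (hm0 : 0 < m) (hmN : m ≤ N.card) (hm : 2 * h ≤ m ∨ m = N.card)
    (𝒮 : Finset (Fin η → Fin h → V)) (h𝒮 : ∀ S ∈ 𝒮, ∀ i j, S i j ∈ N) :
    (𝒮.card : ℝ) * (N.card.choose m : ℝ) ^ η ≤ ((2 * N.card : ℝ) ^ h) ^ η *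
      (((Fintype.piFinset fun _ : Fin η => N.powersetCard m).filter
        (fun T => ∃ S ∈ 𝒮, ∀ i j, S i j ∈ T i)).card : ℝ) := by
  set Ω := Fintype.piFinset fun _ : Fin η => N.powersetCard m
  set succ := Ω.filter (fun T => ∃ S ∈ 𝒮, ∀ i j, S i j ∈ T i)
  have hmR : (0 : ℝ) < m := by exact_mod_cast hm0
  have hNR : (0 : ℝ) < N.card := by exact_mod_cast hm0.trans_le hmN
  -- Double counting of the pairs `(S, T)` with `S ∈ 𝒮` contained in `T`. Each `S` lies in many `T`
  -- (`hlow`), while a successful `T` contains at most `m^(hη)` sequences (`hup`); the powers of `m`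
  -- cancel.
  have hlow : ∀ S ∈ 𝒮, (((m : ℝ) / (2 * N.card)) ^ h * (N.card.choose m)) ^ η ≤
      ((Ω.filter (fun T => ∀ i j, S i j ∈ T i)).card : ℝ) := by
    intro S hS
    have heq : Ω.filter (fun T => ∀ i j, S i j ∈ T i) = Fintype.piFinset fun i : Fin η =>
        (N.powersetCard m).filter (fun T => Finset.univ.image (S i) ⊆ T) := by
      ext T
      simp only [Ω, Finset.mem_filter, Fintype.mem_piFinset, Finset.image_subset_iff,
        Finset.mem_univ, true_implies]
      exact ⟨fun h i => ⟨h.1 i, h.2 i⟩, fun h => ⟨fun i => (h i).1, fun i => (h i).2⟩⟩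
    rw [heq, Fintype.card_piFinset]
    push_cast
    have hp : (((m : ℝ) / (2 * N.card)) ^ h * (N.card.choose m)) ^ η =
        ∏ _i : Fin η, (((m : ℝ) / (2 * N.card)) ^ h * (N.card.choose m)) := by simp
    rw [hp]
    refine Finset.prod_le_prod (fun i _ => by positivity) fun i _ => ?_
    refine le_card_powersetCard_filter_superset ?_ ?_ hmN hm
    · intro x hx
      obtain ⟨j, _, rfl⟩ := Finset.mem_image.1 hx
      exact h𝒮 S hS i j
    · exact Finset.card_image_le.trans (by simp)
  have hup : ∀ T ∈ Ω, (((𝒮.filter (fun S => ∀ i j, S i j ∈ T i)).card : ℕ) : ℝ) ≤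
      if T ∈ succ then ((m : ℝ) ^ h) ^ η else 0 := by
    intro T hT
    split_ifs with hs
    · have hsub : 𝒮.filter (fun S => ∀ i j, S i j ∈ T i) ⊆
          Fintype.piFinset fun i : Fin η => Fintype.piFinset fun _ : Fin h => T i := by
        intro S hS
        simpa using (Finset.mem_filter.1 hS).2
      have := Finset.card_le_card hsub
      have hTc : ∀ i, (T i).card = m := fun i =>
        (Finset.mem_powersetCard.1 (Fintype.mem_piFinset.1 hT i)).2
      simp only [Fintype.card_piFinset, hTc, Finset.prod_const, Finset.card_univ,
        Fintype.card_fin] at this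
      exact_mod_cast this
    · have : 𝒮.filter (fun S => ∀ i j, S i j ∈ T i) = ∅ := by
        rw [Finset.filter_eq_empty_iff]
        intro S hS hc
        exact hs (Finset.mem_filter.2 ⟨hT, S, hS, hc⟩)
      simp [this]
  have hdc : ∑ S ∈ 𝒮, (((Ω.filter (fun T => ∀ i j, S i j ∈ T i)).card : ℕ) : ℝ) =
      ∑ T ∈ Ω, (((𝒮.filter (fun S => ∀ i j, S i j ∈ T i)).card : ℕ) : ℝ) := by
    exact_mod_cast Finset.sum_card_bipartiteAbove_eq_sum_card_bipartiteBelow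
      (s := 𝒮) (t := Ω) (fun S T => ∀ i j, S i j ∈ T i)
  have h1 : (𝒮.card : ℝ) * (((m : ℝ) / (2 * N.card)) ^ h * (N.card.choose m)) ^ η ≤
      succ.card * ((m : ℝ) ^ h) ^ η := by
    calc _ = ∑ S ∈ 𝒮, (((m : ℝ) / (2 * N.card)) ^ h * (N.card.choose m)) ^ η := by simp
      _ ≤ _ := Finset.sum_le_sum hlow
      _ = _ := hdc
      _ ≤ _ := Finset.sum_le_sum hup
      _ = _ := by
        rw [← Finset.sum_filter, Finset.filter_mem_eq_inter,
          Finset.inter_eq_right.2 (Finset.filter_subset _ _)]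
        rw [Finset.sum_const, nsmul_eq_mul]
  have hpos : (0 : ℝ) < ((m : ℝ) ^ h) ^ η / ((2 * N.card : ℝ) ^ h) ^ η := by positivity
  refine le_of_mul_le_mul_right ?_ hpos
  calc _ = (𝒮.card : ℝ) * (((m : ℝ) / (2 * N.card)) ^ h * (N.card.choose m)) ^ η := by
        rw [mul_pow (((m : ℝ) / (2 * N.card)) ^ h), div_pow, div_pow]
        ring
    _ ≤ _ := h1
    _ = _ := by
        field_simp

/-- `x` with the membership of the elements of `B` replaced by the predicate `J`. -/
def replaceOn {V : Type*} (B : Finset V) (J : V → Prop) (x : Finset V) : Finset V :=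
  (x \ B) ∪ B.filter J

theorem mem_replaceOn {V : Type*} {B : Finset V} {J : V → Prop} {x : Finset V} {v : V} :
    v ∈ replaceOn B J x ↔ (v ∈ B ∧ J v) ∨ (v ∈ x ∧ v ∉ B) := by
  simp [replaceOn, or_comm]

/-- Stepwise replacement on disjoint sets `B 0, B 1, …`, where each step succeeds for a proportion
`p` of its samples, succeeds for a proportion `p ^ n` of all sequences of samples. -/
theorem pow_mul_card_le_card_sequences {V τ : Type*} [Fintype V] (Y : Finset τ) (I : Finset ℤ)
    {p : ℝ} (hp : 0 ≤ p) (f : Finset V → ℝ) (Inv : Finset V → Prop) (n : ℕ) :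
    ∀ (B : Fin n → Finset V) (J : Fin n → τ → ℤ → V → Prop) (loss : Fin n → ℝ),
      (∀ i j, i ≠ j → Disjoint (B i) (B j)) →
      (∀ i x, Inv x → ∃ k ∈ I, p * Y.card ≤ ((Y.filter (fun z =>
        Inv (replaceOn (B i) (J i z k) x) ∧
          f (replaceOn (B i) (J i z k) x) ≤ f x + loss i)).card : ℝ)) →
      ∀ x, Inv x → (p * Y.card) ^ n ≤ (((Fintype.piFinset fun _ : Fin n => Y).filter (fun S =>
        ∃ k : Fin n → ℤ, (∀ i, k i ∈ I) ∧
          f (Finset.univ.filter (fun v => (∃ i, v ∈ B i ∧ J i (S i) (k i) v) ∨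
            (v ∈ x ∧ ∀ i, v ∉ B i))) ≤ f x + ∑ i, loss i)).card : ℝ) := by
  induction n with
  | zero =>
    intro B J loss _ _ x _
    simp
  | succ n ih =>
    intro B J loss hB H x hx
    obtain ⟨k₀, hk₀, hcard⟩ := H 0 x hx
    set G₀ := Y.filter (fun z => Inv (replaceOn (B 0) (J 0 z k₀) x) ∧
      f (replaceOn (B 0) (J 0 z k₀) x) ≤ f x + loss 0)
    rw [← Finset.sum_boole, sum_piFinset_cons]
    -- Which later samples are favourable depends on `z` through the modified set, so the induction
    -- hypothesis is applied to that set and not to `x`.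
    have htail : ∀ z ∈ G₀, (p * Y.card) ^ n ≤ ∑ S ∈ Fintype.piFinset (fun _ : Fin n => Y),
        (if ∃ k : Fin (n + 1) → ℤ, (∀ i, k i ∈ I) ∧
          f (Finset.univ.filter (fun v =>
            (∃ i, v ∈ B i ∧ J i ((Fin.cons z S : Fin (n + 1) → τ) i) (k i) v) ∨
            (v ∈ x ∧ ∀ i, v ∉ B i))) ≤ f x + ∑ i, loss i then (1 : ℝ) else 0) := by
      intro z hz
      have hz' := (Finset.mem_filter.1 hz).2
      refine (ih (fun i => B i.succ) (fun i => J i.succ) (fun i => loss i.succ)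
        (fun i j hij => hB _ _ (fun h => hij (Fin.succ_injective _ h)))
        (fun i => H i.succ) _ hz'.1).trans ?_
      rw [← Finset.sum_boole]
      refine Finset.sum_le_sum fun S _ => ?_
      split_ifs with h1 h2 h2
      · exact le_rfl
      · exfalso
        apply h2
        obtain ⟨k, hk, hf⟩ := h1
        refine ⟨Fin.cons k₀ k, Fin.cases (by simpa using hk₀) (by simpa using hk), ?_⟩
        rw [Fin.sum_univ_succ]
        refine le_trans (le_of_eq ?_) (hf.trans (by linarith [hz'.2]))
        congr 1
        ext v
        simp only [Finset.mem_filter, Finset.mem_univ, true_and, Fin.exists_fin_succ,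
          Fin.forall_fin_succ, Fin.cons_zero, Fin.cons_succ, mem_replaceOn]
        have hd : v ∈ B 0 → ∀ i : Fin n, v ∉ B i.succ := fun h0 i hi =>
          Finset.disjoint_left.1 (hB 0 i.succ (Fin.succ_ne_zero i).symm) h0 hi
        by_cases h0 : v ∈ B 0
        · have := hd h0
          simp only [h0, this]
          simp
        · simp [h0]
      · norm_num
      · exact le_rfl
    calc (p * Y.card) ^ (n + 1) = (p * Y.card) * (p * Y.card) ^ n := by ring
      _ ≤ G₀.card * (p * Y.card) ^ n := by gcongr
      _ = ∑ z ∈ G₀, (p * Y.card) ^ n := by simp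
      _ ≤ _ := Finset.sum_le_sum htail
      _ ≤ _ := Finset.sum_le_sum_of_subset_of_nonneg (Finset.filter_subset _ _)
          fun z _ _ => Finset.sum_nonneg fun S _ => by split_ifs <;> norm_num

end Counting

/-! ### Costs of single pairs and affinities -/

section PairCost

variable {V : Type u} (G : SimpleGraph V) (w : Sym2 V → ℝ)

/-- The cost of the ordered pair `(v, u)`, which lies inside a cluster if `I` holds. -/
def pairCost (v u : V) (I : Prop) : ℝ :=
  if v = u then 0 else if G.Adj v u then if I then 0 else w s(v, u) else if I then 1 else 0

theorem pairCost_comm (v u : V) (I : Prop) : pairCost G w v u I = pairCost G w u v I := by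
  simp only [pairCost, eq_comm (a := v), G.adj_comm v, Sym2.eq_swap (a := v)]

/-- The saving from having `u` in the cluster of `v`: the weight of an edge, `-1` for a nonedge. -/
def affinity (v u : V) : ℝ := if G.Adj v u then w s(v, u) else -1

/-- A vertex counts as a nonneighbour of itself. This agrees with the `-1` terms of the two
estimates, and batches with a single vertex depend on the sign. -/
theorem affinity_self (v : V) : affinity G w v v = -1 := by simp [affinity]

theorem pairCost_eq {v u : V} (h : v ≠ u) (I : Prop) :
    pairCost G w v u I =
      (if G.Adj v u then w s(v, u) else 0) - if I then affinity G w v u else 0 := by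
  unfold pairCost affinity
  split_ifs <;> simp_all

theorem affinity_eq (v u : V) :
    affinity G w v u = wdegIn G w v {u} + degIn G v {u} - 1 := by
  unfold affinity wdegIn degIn
  rw [Finset.filter_singleton]
  split_ifs <;> simp

theorem sum_affinity (v : V) (S : Finset V) :
    ∑ u ∈ S, affinity G w v u = wdegIn G w v S + degIn G v S - S.card := by
  unfold wdegIn degIn
  rw [Finset.sum_filter, Finset.card_filter]
  push_cast
  rw [← Finset.sum_add_distrib, Finset.card_eq_sum_ones]
  push_cast
  rw [← Finset.sum_sub_distrib]
  refine Finset.sum_congr rfl fun u _ => ?_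
  unfold affinity
  split_ifs <;> ring

variable {G w}

theorem IsWeight.one_le {W : ℝ} (hw : IsWeight G w W) {v u : V} (h : G.Adj v u) :
    1 ≤ w s(v, u) := (hw.1 _ h).1

theorem IsWeight.le {W : ℝ} (hw : IsWeight G w W) {v u : V} (h : G.Adj v u) :
    w s(v, u) ≤ W := (hw.1 _ h).2

theorem pairCost_nonneg {W : ℝ} (hw : IsWeight G w W) (v u : V) (I : Prop) :
    0 ≤ pairCost G w v u I := by
  unfold pairCost
  split_ifs with h1 h2
  all_goals first | exact le_rfl | exact zero_le_one | linarith [hw.one_le h2]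

theorem pairCost_le {W : ℝ} (hw : IsWeight G w W) (hW : 1 ≤ W) (v u : V) (I : Prop) :
    pairCost G w v u I ≤ if v = u then 0 else W := by
  unfold pairCost
  split_ifs with h1 h2
  all_goals first | exact le_rfl | exact hw.le h2 | linarith

theorem abs_affinity_le {W : ℝ} (hw : IsWeight G w W) (hW : 1 ≤ W) (v u : V) :
    |affinity G w v u| ≤ W := by
  unfold affinity
  split_ifs with h
  · rw [abs_of_nonneg (by linarith [hw.one_le h])]
    exact hw.le h
  · simpa using hW

end PairCost

/-! ### The cost as a sum over ordered pairs, and its change under `𝒞 + X` -/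

section CostFormula

variable {V : Type u} [Fintype V] (G : SimpleGraph V) (w : Sym2 V → ℝ)

theorem two_mul_sum_edgeFinset (H : SimpleGraph V) [Fintype H.edgeSet] (f : Sym2 V → ℝ) :
    2 * ∑ e ∈ H.edgeFinset, f e = ∑ v, ∑ u, if H.Adj v u then f s(v, u) else 0 := by
  rw [← Finset.sum_product', ← Finset.sum_filter]
  rw [← Finset.sum_fiberwise_of_maps_to (t := H.edgeFinset) (g := fun p : V × V => s(p.1, p.2))]
  · rw [Finset.mul_sum]
    refine Finset.sum_congr rfl fun e he => ?_
    induction e using Sym2.ind with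
    | _ a b =>
      have hab : H.Adj a b := by simpa using he
      have : (((Finset.univ ×ˢ Finset.univ : Finset (V × V)).filter
          (fun x => H.Adj x.1 x.2)).filter (fun p => s(p.1, p.2) = s(a, b))) = {(a, b), (b, a)} := by
        ext ⟨x, y⟩
        simp only [Finset.mem_filter, Finset.mem_product, Finset.mem_univ, true_and, and_self,
          Sym2.eq_iff, Finset.mem_insert, Finset.mem_singleton, Prod.mk.injEq]
        constructor
        · exact fun h => h.2
        · rintro (⟨rfl, rfl⟩ | ⟨rfl, rfl⟩)
          · simp [hab]
          · simp [hab.symm]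
      rw [this, Finset.sum_pair]
      · rw [Sym2.eq_swap (a := b)]
        ring
      · intro h
        exact hab.ne (Prod.mk.inj h).1
  · intro p hp
    simpa using (Finset.mem_filter.1 hp).2

theorem inside_iff (𝒞 : Clustering V) (v u : V) : Inside 𝒞 s(v, u) ↔ u ∈ 𝒞.part v := by
  rw [Finpartition.mem_part_iff_exists]
  simp only [Inside, Sym2.mem_iff, forall_eq_or_imp, forall_eq]
  exact exists_congr fun C => and_congr_right fun _ => and_comm

theorem mem_part_comm (𝒞 : Clustering V) (v u : V) : u ∈ 𝒞.part v ↔ v ∈ 𝒞.part u := by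
  rw [Finpartition.mem_part_iff_exists, Finpartition.mem_part_iff_exists]
  exact exists_congr fun C => and_congr_right fun _ => and_comm

theorem two_mul_cost {W : ℝ} (hw : IsWeight G w W) (𝒞 : Clustering V) :
    2 * cost G w 𝒞 = ∑ v, ∑ u, pairCost G w v u (u ∈ 𝒞.part v) := by
  rw [cost, Finset.sum_filter, Finset.sum_filter, mul_add, two_mul_sum_edgeFinset,
    two_mul_sum_edgeFinset, ← Finset.sum_add_distrib]
  refine Finset.sum_congr rfl fun v _ => ?_
  rw [← Finset.sum_add_distrib]
  refine Finset.sum_congr rfl fun u _ => ?_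
  simp only [inside_iff, pairCost, SimpleGraph.compl_adj]
  by_cases hvu : v = u
  · simp [hvu]
  by_cases ha : G.Adj v u
  · simp [hvu, ha]
  · have : w s(v, u) = 1 := hw.2 _ (by simp [hvu, ha])
    simp [hvu, ha, this]

variable {G w}

theorem cost_nonneg {W : ℝ} (hw : IsWeight G w W) (𝒞 : Clustering V) : 0 ≤ cost G w 𝒞 := by
  have := two_mul_cost G w hw 𝒞
  have h : 0 ≤ ∑ v, ∑ u, pairCost G w v u (u ∈ 𝒞.part v) :=
    Finset.sum_nonneg fun v _ => Finset.sum_nonneg fun u _ => pairCost_nonneg hw v u _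
  linarith

theorem cost_le {W : ℝ} (hw : IsWeight G w W) (hW : 1 ≤ W) (𝒞 : Clustering V) :
    cost G w 𝒞 ≤ W * (Fintype.card V : ℝ) ^ 2 := by
  have := two_mul_cost G w hw 𝒞
  have h : ∑ v, ∑ u, pairCost G w v u (u ∈ 𝒞.part v) ≤ ∑ _v : V, ∑ _u : V, W := by
    refine Finset.sum_le_sum fun v _ => Finset.sum_le_sum fun u _ => (pairCost_le hw hW v u _).trans ?_
    split_ifs <;> linarith
  simp only [Finset.sum_const, Finset.card_univ, nsmul_eq_mul] at h
  have h2 : 0 ≤ W * (Fintype.card V : ℝ) ^ 2 := by positivity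
  nlinarith

theorem mem_parts_addCluster {𝒞 : Clustering V} {X C : Finset V} :
    C ∈ (addCluster 𝒞 X).parts ↔
      (C = X ∧ X.Nonempty) ∨ ∃ D ∈ 𝒞.parts, ¬ D ⊆ X ∧ D \ X = C := by
  unfold addCluster
  rcases X.eq_empty_or_nonempty with rfl | hX
  · rw [Finpartition.parts_extendOfLE_of_eq _ (by simp)]
    rw [Finpartition.mem_avoid]
    simp
  · rw [Finpartition.parts_extendOfLE_of_lt _
      (Finset.sdiff_ssubset (Finset.subset_univ X) hX), Finset.mem_insert,
      Finpartition.mem_avoid, Finset.sdiff_sdiff_eq_self (Finset.subset_univ X)]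
    simp [hX]

theorem mem_part_addCluster {𝒞 : Clustering V} {X : Finset V} {v u : V} :
    u ∈ (addCluster 𝒞 X).part v ↔
      (u ∈ X ∧ v ∈ X) ∨ (u ∉ X ∧ v ∉ X ∧ u ∈ 𝒞.part v) := by
  rw [Finpartition.mem_part_iff_exists]
  constructor
  · rintro ⟨C, hC, hu, hv⟩
    rcases mem_parts_addCluster.1 hC with ⟨rfl, _⟩ | ⟨D, hD, _, rfl⟩
    · exact Or.inl ⟨hu, hv⟩
    · rw [Finset.mem_sdiff] at hu hv
      exact Or.inr ⟨hu.2, hv.2, 𝒞.mem_part_iff_exists.2 ⟨D, hD, hu.1, hv.1⟩⟩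
  · rintro (⟨hu, hv⟩ | ⟨hu, hv, huv⟩)
    · exact ⟨X, mem_parts_addCluster.2 (Or.inl ⟨rfl, u, hu⟩), hu, hv⟩
    · obtain ⟨D, hD, huD, hvD⟩ := 𝒞.mem_part_iff_exists.1 huv
      exact ⟨D \ X, mem_parts_addCluster.2 (Or.inr ⟨D, hD, fun h => hu (h huD), rfl⟩),
        Finset.mem_sdiff.2 ⟨huD, hu⟩, Finset.mem_sdiff.2 ⟨hvD, hv⟩⟩

theorem clustering_ext {𝒞 𝒟 : Clustering V} (h : ∀ v u, u ∈ 𝒞.part v ↔ u ∈ 𝒟.part v) : 𝒞 = 𝒟 := by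
  have key : ∀ 𝒞 𝒟 : Clustering V, (∀ v u, u ∈ 𝒞.part v ↔ u ∈ 𝒟.part v) →
      ∀ C ∈ 𝒞.parts, C ∈ 𝒟.parts := by
    intro 𝒞 𝒟 h C hC
    obtain ⟨v, hv⟩ := 𝒞.nonempty_of_mem_parts hC
    have h1 : C = 𝒟.part v := by
      rw [← 𝒞.part_eq_of_mem hC hv]
      ext u
      exact h v u
    rw [h1]
    exact 𝒟.part_mem.2 (Finset.mem_univ v)
  exact Finpartition.ext (Finset.Subset.antisymm (key _ _ h) (key _ _ fun v u => (h v u).symm))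

theorem addCluster_of_mem_parts {𝒞 : Clustering V} {C : Finset V} (hC : C ∈ 𝒞.parts) :
    addCluster 𝒞 C = 𝒞 := by
  refine clustering_ext fun v u => ?_
  rw [mem_part_addCluster]
  by_cases hv : v ∈ C
  · simp [hv, 𝒞.part_eq_of_mem hC hv]
  · by_cases hu : u ∈ C
    · have : u ∉ 𝒞.part v := fun h => by
        rw [mem_part_comm, 𝒞.part_eq_of_mem hC hu] at h
        exact hv h
      simp [hu, hv, this]
    · simp [hu, hv]

variable (G w)

/-- The affinity, doubled for the vertices of the present cluster of `v`. -/
def moveAffinity (𝒞 : Clustering V) (v u : V) : ℝ :=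
  if u ∈ 𝒞.part v then 2 * affinity G w v u else affinity G w v u

/-- The saving from moving `v` to the new cluster, as far as it concerns vertices outside `B`,
if the new cluster is `X` outside `B`. -/
def moveGain (𝒞 : Clustering V) (B X : Finset V) (v : V) : ℝ :=
  ∑ u ∈ X \ B, moveAffinity G w 𝒞 v u - ∑ u ∈ 𝒞.part v \ B, affinity G w v u

/-- Moving `v` into a new cluster `X` gains its affinity to `X` and loses that to `C(v) ∖ X`. Since
the sum over `C(v) ∖ X` is the sum over `C(v)` minus the sum over `C(v) ∩ X`, the net gain is the
sum of `moveAffinity` over `X` minus the known sum of `affinity` over `C(v)`. Only the first sum is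
estimated from the sample. -/
theorem estCostStays_sub_estCostMoves (𝒞 : Clustering V) {h : ℕ} (hh : 0 < h) (S : Fin h → V)
    (s : ℝ) (v : V) :
    estCostStays G w 𝒞 S s v - estCostMoves G w S s v =
      s / h * ∑ j, moveAffinity G w 𝒞 v (S j) - ∑ u ∈ 𝒞.part v, affinity G w v u := by
  have h0 : (h : ℝ) ≠ 0 := by exact_mod_cast hh.ne'
  have hsum : ∑ j, moveAffinity G w 𝒞 v (S j) =
      (∑ j, if S j ∈ 𝒞.part v then wdegIn G w v {S j} + degIn G v {S j} - 1 else 0) +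
        ∑ j, (wdegIn G w v {S j} + degIn G v {S j}) - h := by
    have : (h : ℝ) = ∑ _j : Fin h, (1 : ℝ) := by simp
    rw [this, ← Finset.sum_add_distrib, ← Finset.sum_sub_distrib]
    refine Finset.sum_congr rfl fun j _ => ?_
    simp only [moveAffinity, affinity_eq]
    split_ifs <;> ring
  rw [hsum, sum_affinity]
  unfold estCostStays estCostMoves
  field_simp
  ring

variable {G w}

theorem abs_moveAffinity_le {W : ℝ} (hw : IsWeight G w W) (hW : 1 ≤ W) (𝒞 : Clustering V) (v u : V) :
    |moveAffinity G w 𝒞 v u| ≤ 2 * W := by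
  have h := abs_affinity_le hw hW v u
  unfold moveAffinity
  split_ifs
  · rw [abs_mul, abs_two]
    linarith
  · linarith

/-- The terms not multiplied by membership of `v` in `X` involve only the part of `X` outside `B`.
Thus the pairs between `B` and its complement contribute to the cost independently for each `v ∈ B`,
and each decision is governed by its own `moveGain`. -/
theorem sum_pairCost_addCluster (𝒞 : Clustering V) (B X : Finset V) {v : V} (hv : v ∈ B) :
    ∑ u ∈ Bᶜ, pairCost G w v u (u ∈ (addCluster 𝒞 X).part v) =
      (∑ u ∈ Bᶜ, if G.Adj v u then w s(v, u) else 0) -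
        (∑ u ∈ (𝒞.part v \ X) \ B, affinity G w v u) -
        if v ∈ X then moveGain G w 𝒞 B X v else 0 := by
  have hset : ∀ S : Finset V, ∀ g : V → ℝ, ∑ u ∈ S \ B, g u = ∑ u ∈ Bᶜ, if u ∈ S then g u else 0 := by
    intro S g
    rw [← Finset.sum_filter]
    refine Finset.sum_congr ?_ fun _ _ => rfl
    ext u
    simp [and_comm]
  unfold moveGain
  rw [hset, hset, hset]
  by_cases hvX : v ∈ X
  · simp only [hvX, if_true]
    rw [← Finset.sum_sub_distrib, ← Finset.sum_sub_distrib, ← Finset.sum_sub_distrib]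
    refine Finset.sum_congr rfl fun u hu => ?_
    have hne : v ≠ u := by
      rintro rfl
      exact (Finset.mem_compl.1 hu) hv
    rw [pairCost_eq G w hne]
    simp only [mem_part_addCluster, hvX, Finset.mem_sdiff, moveAffinity]
    by_cases h1 : u ∈ X <;> by_cases h2 : u ∈ 𝒞.part v <;> (simp [h1, h2]; try ring)
  · simp only [hvX, if_false, sub_zero]
    rw [← Finset.sum_sub_distrib]
    refine Finset.sum_congr rfl fun u hu => ?_
    have hne : v ≠ u := by
      rintro rfl
      exact (Finset.mem_compl.1 hu) hv
    rw [pairCost_eq G w hne]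
    simp only [mem_part_addCluster, hvX, Finset.mem_sdiff]
    by_cases h1 : u ∈ X <;> by_cases h2 : u ∈ 𝒞.part v <;> simp [h1, h2]

theorem two_mul_cost_split {W : ℝ} (hw : IsWeight G w W) (𝒞 : Clustering V) (B : Finset V) :
    2 * cost G w 𝒞 = ∑ v ∈ B, ∑ u ∈ B, pairCost G w v u (u ∈ 𝒞.part v) +
      2 * ∑ v ∈ B, ∑ u ∈ Bᶜ, pairCost G w v u (u ∈ 𝒞.part v) +
      ∑ v ∈ Bᶜ, ∑ u ∈ Bᶜ, pairCost G w v u (u ∈ 𝒞.part v) := by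
  rw [two_mul_cost G w hw, ← Finset.sum_add_sum_compl B]
  simp_rw [← Finset.sum_add_sum_compl B (fun u => pairCost G w _ u _)]
  rw [Finset.sum_add_distrib, Finset.sum_add_distrib]
  have : ∑ v ∈ Bᶜ, ∑ u ∈ B, pairCost G w v u (u ∈ 𝒞.part v) =
      ∑ v ∈ B, ∑ u ∈ Bᶜ, pairCost G w v u (u ∈ 𝒞.part v) := by
    rw [Finset.sum_comm]
    refine Finset.sum_congr rfl fun v _ => Finset.sum_congr rfl fun u _ => ?_
    rw [pairCost_comm, mem_part_comm]
  rw [this]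
  ring

/-- The change of cost when the new cluster changes on `B`. -/
theorem cost_addCluster_le {W : ℝ} (hw : IsWeight G w W) (hW : 1 ≤ W) (𝒞 : Clustering V)
    {B X X' : Finset V} (hX : ∀ v, v ∉ B → (v ∈ X' ↔ v ∈ X)) :
    cost G w (addCluster 𝒞 X') ≤ cost G w (addCluster 𝒞 X) +
      ∑ v ∈ B, ((if v ∈ X then moveGain G w 𝒞 B X v else 0) -
        if v ∈ X' then moveGain G w 𝒞 B X v else 0) + W * (B.card * (B.card - 1)) / 2 := by
  have h1 := two_mul_cost_split hw (addCluster 𝒞 X) B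
  have h2 := two_mul_cost_split hw (addCluster 𝒞 X') B
  have hcc : ∑ v ∈ Bᶜ, ∑ u ∈ Bᶜ, pairCost G w v u (u ∈ (addCluster 𝒞 X').part v) =
      ∑ v ∈ Bᶜ, ∑ u ∈ Bᶜ, pairCost G w v u (u ∈ (addCluster 𝒞 X).part v) := by
    refine Finset.sum_congr rfl fun v hv => Finset.sum_congr rfl fun u hu => ?_
    simp only [mem_part_addCluster, hX v (Finset.mem_compl.1 hv), hX u (Finset.mem_compl.1 hu)]
  have hYY : X' \ B = X \ B := by
    ext u
    simp only [Finset.mem_sdiff]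
    exact and_congr_left fun h => hX u h
  have hgain : ∀ v, moveGain G w 𝒞 B X' v = moveGain G w 𝒞 B X v := by
    intro v
    unfold moveGain
    rw [hYY]
  have hpart : ∀ v, (𝒞.part v \ X') \ B = (𝒞.part v \ X) \ B := by
    intro v
    ext u
    simp only [Finset.mem_sdiff]
    exact and_congr_left fun h => by rw [hX u h]
  have hbc : ∑ v ∈ B, ∑ u ∈ Bᶜ, pairCost G w v u (u ∈ (addCluster 𝒞 X').part v) =
      ∑ v ∈ B, ∑ u ∈ Bᶜ, pairCost G w v u (u ∈ (addCluster 𝒞 X).part v) +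
      ∑ v ∈ B, ((if v ∈ X then moveGain G w 𝒞 B X v else 0) -
        if v ∈ X' then moveGain G w 𝒞 B X v else 0) := by
    rw [← Finset.sum_add_distrib]
    refine Finset.sum_congr rfl fun v hv => ?_
    rw [sum_pairCost_addCluster 𝒞 B X' hv, sum_pairCost_addCluster 𝒞 B X hv, hpart, hgain]
    ring
  -- Pairs inside `B` are bounded trivially, by `W` each. This is affordable because a batch has
  -- about `|D(r)|/η` vertices.
  have hbb : ∑ v ∈ B, ∑ u ∈ B, pairCost G w v u (u ∈ (addCluster 𝒞 X').part v) ≤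
      W * (B.card * (B.card - 1)) := by
    calc _ ≤ ∑ v ∈ B, ∑ u ∈ B, (if v = u then 0 else W) :=
          Finset.sum_le_sum fun v _ => Finset.sum_le_sum fun u _ => pairCost_le hw hW v u _
      _ = ∑ v ∈ B, (B.card * W - W) := by
          refine Finset.sum_congr rfl fun v hv => ?_
          have : ∀ u ∈ B, (if v = u then (0 : ℝ) else W) = W - if v = u then W else 0 := by
            intro u _
            split_ifs <;> simp
          rw [Finset.sum_congr rfl this, Finset.sum_sub_distrib, Finset.sum_ite_eq, if_pos hv]
          simp
      _ = _ := by
          rw [Finset.sum_const, nsmul_eq_mul]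
          ring
  have hbb' : 0 ≤ ∑ v ∈ B, ∑ u ∈ B, pairCost G w v u (u ∈ (addCluster 𝒞 X).part v) :=
    Finset.sum_nonneg fun v _ => Finset.sum_nonneg fun u _ => pairCost_nonneg hw v u _
  linarith

end CostFormula

/-! ### One batch: size guesses, accuracy of the sample, loss of cost -/

section Batches

/-- Below the smallest guess, that guess is itself at most `x/η`. Above it, rounding `z` down to a
guess loses at most `z(b - 1) ≤ x/η`. -/
theorem exists_zpow_near {g x b : ℝ} {κ η : ℕ} (hη : 0 < η) (hg : 0 < g) (hb : 1 < b)
    (hbη : b - 1 ≤ 1 / η) (hup : x ≤ g * b ^ κ)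
    (hlow : g * b ^ (-(κ : ℤ)) ≤ x / η) {z : ℝ} (hz : 0 ≤ z) (hzx : z ≤ x) :
    ∃ k ∈ Finset.Icc (-(κ : ℤ)) κ, |g * b ^ k - z| ≤ x / η := by
  have hη' : (0 : ℝ) < η := by exact_mod_cast hη
  have hb0 : 0 < b := by linarith
  by_cases hlo : z ≤ g * b ^ (-(κ : ℤ))
  · refine ⟨-κ, by simp, ?_⟩
    rw [abs_of_nonneg (by linarith)]
    linarith
  · push Not at hlo
    have hzg : 0 < z / g := by
      have : 0 < g * b ^ (-(κ : ℤ)) := by positivity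
      exact div_pos (this.trans hlo) hg
    obtain ⟨k, hk1, hk2⟩ := exists_mem_Ico_zpow hzg hb
    rw [le_div_iff₀ hg] at hk1
    rw [div_lt_iff₀ hg] at hk2
    refine ⟨k, ?_, ?_⟩
    · rw [Finset.mem_Icc]
      constructor
      · have h1 : b ^ (-(κ : ℤ)) < b ^ (k + 1) := by
          refine lt_of_mul_lt_mul_left ?_ hg.le
          linarith
        have := (zpow_lt_zpow_iff_right₀ hb).1 h1
        omega
      · have h1 : b ^ k ≤ b ^ (κ : ℤ) := by
          refine le_of_mul_le_mul_left ?_ hg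
          rw [zpow_natCast]
          linarith
        exact (zpow_le_zpow_iff_right₀ hb).1 h1
    · have h1 : b ^ (k + 1) = b ^ k * b := zpow_add_one₀ hb0.ne' k
      rw [h1] at hk2
      rw [abs_sub_comm, abs_of_nonneg (by linarith)]
      have h2 : b ^ k * g * (b - 1) ≤ x * (1 / η) :=
        mul_le_mul (by linarith) hbη (by linarith) (by linarith)
      rw [mul_one_div] at h2
      nlinarith

/-- For every set `Z` of vertices of `N` there is a size guess with which a positive proportion of
all samples from `N` estimates the sums of the functions `ψ v`, `v ∈ B`, over `Z`. -/
theorem exists_guess_card_filter_sample {V : Type*} {N Z : Finset V} (hZ : Z ⊆ N) (B : Finset V)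
    (ψ : V → V → ℝ) {W g b : ℝ} {κ η h : ℕ} (hη : 2 ≤ η) (hh : h = η ^ 5) (hW : 0 < W)
    (hψ : ∀ v u, |ψ v u| ≤ 2 * W) (hg : 0 < g) (hb : 1 < b)
    (hbη : b - 1 ≤ 1 / η) (hup : N.card ≤ g * b ^ κ)
    (hlow : g * b ^ (-(κ : ℤ)) ≤ N.card / η) :
    ∃ k ∈ Finset.Icc (-(κ : ℤ)) κ,
      (1 / (η : ℝ)) ^ h / 2 * (N.card : ℝ) ^ h ≤
      (((Fintype.piFinset (fun _ : Fin h => N)).filter (fun S =>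
        ∑ v ∈ B, |g * b ^ k / h * ∑ j, ψ v (S j) - ∑ u ∈ Z, ψ v u| ≤
          B.card * (4 * W * N.card / η))).card : ℝ) := by
  have hη' : (2 : ℝ) ≤ η := by exact_mod_cast hη
  have hh0 : 0 < h := by rw [hh]; positivity
  have hhR : (0 : ℝ) < h := by exact_mod_cast hh0
  have hb0 : 0 < b := by linarith
  have hsamp : ∀ (S : Fin h → V) v, |∑ j, ψ v (S j)| ≤ h * (2 * W) := fun S v =>
    (Finset.abs_sum_le_sum_abs _ _).trans ((Finset.sum_le_sum fun j _ => hψ v (S j)).trans (by simp))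
  have hsamp' : ∀ (c : ℝ) (S : Fin h → V) v, |c / h * ∑ j, ψ v (S j)| ≤ |c| * (2 * W) := by
    intro c S v
    rw [abs_mul, abs_div, abs_of_pos hhR]
    calc |c| / h * |∑ j, ψ v (S j)| ≤ |c| / h * (h * (2 * W)) := by
          gcongr
          exact hsamp S v
      _ = _ := by field_simp
  -- If `Z` is small, sequences inside `Z` are too rare. But the true sum is then negligible, and so
  -- is every estimate made with the smallest size guess, whatever the sample.
  by_cases hsmall : (Z.card : ℝ) < N.card / η
  · refine ⟨-κ, by simp, ?_⟩
    rw [Finset.filter_true_of_mem]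
    · simp only [Fintype.card_piFinset, Finset.prod_const, Finset.card_univ, Fintype.card_fin]
      push_cast
      refine mul_le_of_le_one_left (by positivity) ?_
      have : (1 / (η : ℝ)) ^ h ≤ 1 := pow_le_one₀ (by positivity) (by
        rw [div_le_one (by linarith)]; linarith)
      linarith
    · intro S _
      have hone : ∀ v ∈ B, |g * b ^ (-(κ : ℤ)) / h * ∑ j, ψ v (S j) - ∑ u ∈ Z, ψ v u| ≤
          4 * W * N.card / η := by
        intro v _
        have h1 := hsamp' (g * b ^ (-(κ : ℤ))) S v
        have h2 : |∑ u ∈ Z, ψ v u| ≤ Z.card * (2 * W) :=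
          (Finset.abs_sum_le_sum_abs _ _).trans
            ((Finset.sum_le_sum fun u _ => hψ v u).trans (by simp))
        rw [abs_of_pos (by positivity : 0 < g * b ^ (-(κ : ℤ)))] at h1
        have h3 := abs_sub (g * b ^ (-(κ : ℤ)) / h * ∑ j, ψ v (S j)) (∑ u ∈ Z, ψ v u)
        have h4 : g * b ^ (-(κ : ℤ)) * (2 * W) ≤ N.card / η * (2 * W) := by gcongr
        have h5 : (Z.card : ℝ) * (2 * W) ≤ N.card / η * (2 * W) := by gcongr
        have h6 : N.card / η * (2 * W) + N.card / η * (2 * W) = 4 * W * N.card / η := by ring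
        linarith
      exact (Finset.sum_le_sum hone).trans (by simp)
  · push Not at hsmall
    have hZN : (Z.card : ℝ) ≤ N.card := by exact_mod_cast Finset.card_le_card hZ
    obtain ⟨k, hk, hkz⟩ := exists_zpow_near (by omega) hg hb hbη hup hlow (z := Z.card)
      (by positivity) hZN
    refine ⟨k, hk, ?_⟩
    -- Only sequences with all entries in `Z` are counted, a proportion `(|Z|/|N|)^h ≥ (1/η)^h`.
    -- With `t = 1/η` and `h = η^5` one has `h t² = η³ ≥ 2`. The sampling error and the error of the
    -- size guess contribute `2W|N|/η` each.
    have hcheb := half_le_card_filter_sample Z hh0 B ψ (M := 2 * W) (t := 1 / η)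
      (by positivity) (by positivity) hψ (by
        rw [hh]
        push_cast
        have h1 : (η : ℝ) ^ 5 * (1 / η) ^ 2 = η ^ 3 := by
          field_simp
        rw [h1]
        calc (2 : ℝ) ≤ η := hη'
          _ ≤ η ^ 3 := le_self_pow₀ (by linarith) (by norm_num))
    refine le_trans ?_ (hcheb.trans ?_)
    · have h1 : (N.card / η : ℝ) ^ h ≤ (Z.card : ℝ) ^ h := by gcongr
      calc _ = (N.card / η : ℝ) ^ h / 2 := by
            rw [div_pow, div_pow, one_pow]
            ring
        _ ≤ _ := by linarith
    · norm_cast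
      refine Finset.card_le_card fun S hS => ?_
      rw [Finset.mem_filter, Fintype.mem_piFinset] at hS ⊢
      refine ⟨fun j => hZ (hS.1 j), ?_⟩
      have hterm : ∀ v ∈ B, |g * b ^ k / h * ∑ j, ψ v (S j) - ∑ u ∈ Z, ψ v u| ≤
          |(Z.card : ℝ) / h * ∑ j, ψ v (S j) - ∑ u ∈ Z, ψ v u| + N.card / η * (2 * W) := by
        intro v _
        have h1 : g * b ^ k / h * ∑ j, ψ v (S j) - ∑ u ∈ Z, ψ v u =
            ((Z.card : ℝ) / h * ∑ j, ψ v (S j) - ∑ u ∈ Z, ψ v u) +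
              (g * b ^ k - Z.card) / h * ∑ j, ψ v (S j) := by ring
        rw [h1]
        refine (abs_add_le _ _).trans ?_
        gcongr
        refine (hsamp' _ S v).trans ?_
        gcongr
      refine (Finset.sum_le_sum hterm).trans ?_
      rw [Finset.sum_add_distrib, Finset.sum_const, nsmul_eq_mul]
      have h2 := hS.2
      have h3 : (B.card : ℝ) * (Z.card * (2 * W) * (1 / η)) ≤
          B.card * (N.card * (2 * W) * (1 / η)) := by gcongr
      have h4 : (B.card : ℝ) * (N.card * (2 * W) * (1 / η)) + B.card * (N.card / η * (2 * W)) =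
          B.card * (4 * W * N.card / η) := by ring
      linarith

variable {V : Type u} [Fintype V] {G : SimpleGraph V} {w : Sym2 V → ℝ}

/-- A set to sample from for the batch `B`: sampling from it estimates the gain of every move
without large errors in the harmful direction. -/
theorem exists_sample_set {W : ℝ} (hw : IsWeight G w W) (hW : 1 ≤ W) (𝒞 : Clustering V)
    {B X N : Finset V} (hX : X ⊆ N) (hB : B ⊆ N) {η : ℕ} (hη : 0 < η)
    (hBN : (η : ℝ) * (B.card - 1) ≤ N.card) :
    ∃ Z ⊆ N, ∀ v ∈ B,
      (0 < moveGain G w 𝒞 B X v → moveGain G w 𝒞 B X v ≤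
        ∑ u ∈ Z, moveAffinity G w 𝒞 v u - ∑ u ∈ 𝒞.part v, affinity G w v u +
          2 * W * N.card / η) ∧
      (moveGain G w 𝒞 B X v ≤ 0 → ∑ u ∈ Z, moveAffinity G w 𝒞 v u -
        ∑ u ∈ 𝒞.part v, affinity G w v u ≤ moveGain G w 𝒞 B X v + 2 * W * N.card / η) := by
  have hη' : (0 : ℝ) < η := by exact_mod_cast hη
  have hslack : 0 ≤ 2 * W * N.card / η := by positivity
  have hpart : ∀ v, ∑ u ∈ 𝒞.part v, affinity G w v u =
      ∑ u ∈ 𝒞.part v \ B, affinity G w v u + ∑ u ∈ 𝒞.part v ∩ B, affinity G w v u := by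
    intro v
    rw [add_comm, Finset.sum_inter_add_sum_sdiff]
  -- The estimate includes the vertices of `C(v) ∩ B`, which `moveGain` omits. For `|B| ≥ 2` this
  -- discrepancy is at most `W|B| ≤ 2W(|B| - 1) ≤ 2W|N|/η`. For `|B| = 1` that bound can fail when
  -- `|N| < η`, and the discrepancy must be given a harmless sign.
  rcases lt_or_ge 1 B.card with h2 | h1
  · refine ⟨X \ B, Finset.sdiff_subset.trans hX, fun v _ => ?_⟩
    have herr : |∑ u ∈ 𝒞.part v ∩ B, affinity G w v u| ≤ 2 * W * N.card / η := by
      calc |∑ u ∈ 𝒞.part v ∩ B, affinity G w v u| ≤ ∑ u ∈ 𝒞.part v ∩ B, W :=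
            (Finset.abs_sum_le_sum_abs _ _).trans
              (Finset.sum_le_sum fun u _ => abs_affinity_le hw hW v u)
        _ = (𝒞.part v ∩ B).card * W := by simp
        _ ≤ B.card * W := by
            gcongr
            exact Finset.inter_subset_right
        _ ≤ 2 * W * (B.card - 1) := by
            have : (2 : ℝ) ≤ B.card := by exact_mod_cast h2
            nlinarith
        _ ≤ 2 * W * (N.card / η) := by
            gcongr
            rw [le_div_iff₀ hη']
            linarith
        _ = _ := by ring
    have := abs_le.1 herr
    rw [hpart v]
    unfold moveGain
    constructor <;> intro _ <;> linarith
  · by_cases hpos : ∃ v ∈ B, moveGain G w 𝒞 B X v ≤ 0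
    · obtain ⟨v, hv, hneg⟩ := hpos
      have hBv : B = {v} := by
        refine Finset.eq_singleton_iff_unique_mem.2 ⟨hv, fun u hu => ?_⟩
        exact Finset.card_le_one.1 h1 u hu v hv
      -- Omitting `v` would overestimate its gain by `1`. Including it in the sampled set adds `2 ·
      -- (-1)`, so a nonpositive gain is underestimated by `1` instead. For a positive gain, treated
      -- below, the overestimate is harmless.
      refine ⟨X \ B ∪ B, Finset.union_subset (Finset.sdiff_subset.trans hX) hB, fun u hu => ?_⟩
      obtain rfl : u = v := by simpa [hBv] using hu
      refine ⟨fun h => absurd hneg (not_le.2 h), fun _ => ?_⟩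
      rw [hpart u, Finset.sum_union Finset.sdiff_disjoint]
      have hself : u ∈ 𝒞.part u := 𝒞.mem_part_self.2 (Finset.mem_univ u)
      have e1 : ∑ x ∈ B, moveAffinity G w 𝒞 u x = -2 := by
        rw [hBv, Finset.sum_singleton, moveAffinity, if_pos hself, affinity_self]
        norm_num
      have e2 : ∑ x ∈ 𝒞.part u ∩ B, affinity G w u x = -1 := by
        rw [hBv, Finset.inter_singleton_of_mem hself, Finset.sum_singleton, affinity_self]
      rw [e1, e2]
      unfold moveGain
      linarith
    · push Not at hpos
      refine ⟨X \ B, Finset.sdiff_subset.trans hX, fun v hv => ?_⟩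
      have hBv : B = {v} := by
        refine Finset.eq_singleton_iff_unique_mem.2 ⟨hv, fun u hu => ?_⟩
        exact Finset.card_le_one.1 h1 u hu v hv
      refine ⟨fun _ => ?_, fun h => absurd h (not_le.2 (hpos v hv))⟩
      rw [hpart v]
      have hself : v ∈ 𝒞.part v := 𝒞.mem_part_self.2 (Finset.mem_univ v)
      have e2 : ∑ x ∈ 𝒞.part v ∩ B, affinity G w v x = -1 := by
        rw [hBv, Finset.inter_singleton_of_mem hself, Finset.sum_singleton, affinity_self]
      rw [e2]
      unfold moveGain
      linarith

/-- One batch: for a suitable size guess, a positive proportion of all samples from `N` changes the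
new cluster on the batch `B` at a small loss. -/
theorem exists_guess_card_filter_batch {W : ℝ} (hw : IsWeight G w W) (hW : 1 ≤ W)
    (𝒞 : Clustering V) {B X N : Finset V} (hX : X ⊆ N) (hB : B ⊆ N) {κ η h : ℕ} (hη : 2 ≤ η)
    (hh : h = η ^ 5) (hBN : (η : ℝ) * (B.card - 1) ≤ N.card) {g b : ℝ} (hg : 0 < g) (hb : 1 < b)
    (hbη : b - 1 ≤ 1 / η) (hup : N.card ≤ g * b ^ κ)
    (hlow : g * b ^ (-(κ : ℤ)) ≤ N.card / η) :
    ∃ k ∈ Finset.Icc (-(κ : ℤ)) κ,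
      (1 / (η : ℝ)) ^ h / 2 * (N.card : ℝ) ^ h ≤
      (((Fintype.piFinset (fun _ : Fin h => N)).filter (fun S =>
        replaceOn B (fun v => estCostMoves G w S (g * b ^ k) v + 6 * (η : ℝ)⁻¹ * W * N.card <
          estCostStays G w 𝒞 S (g * b ^ k) v) X ⊆ N ∧
        cost G w (addCluster 𝒞 (replaceOn B (fun v => estCostMoves G w S (g * b ^ k) v +
          6 * (η : ℝ)⁻¹ * W * N.card < estCostStays G w 𝒞 S (g * b ^ k) v) X)) ≤
          cost G w (addCluster 𝒞 X) + B.card * (13 * W * N.card / η))).card : ℝ) := by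
  have hη' : (2 : ℝ) ≤ η := by exact_mod_cast hη
  have hh0 : 0 < h := by rw [hh]; positivity
  obtain ⟨Z, hZ, hgain⟩ := exists_sample_set hw hW 𝒞 hX hB (by omega) hBN
  obtain ⟨k, hk, hcard⟩ := exists_guess_card_filter_sample hZ B (moveAffinity G w 𝒞) hη hh
    (by linarith) (abs_moveAffinity_le hw hW 𝒞) hg hb hbη hup hlow
  refine ⟨k, hk, hcard.trans ?_⟩
  norm_cast
  refine Finset.card_le_card fun S hS => ?_
  rw [Finset.mem_filter] at hS ⊢
  obtain ⟨hSN, herr⟩ := hS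
  set J : V → Prop := fun v => estCostMoves G w S (g * b ^ k) v + 6 * (η : ℝ)⁻¹ * W * N.card <
          estCostStays G w 𝒞 S (g * b ^ k) v
  refine ⟨hSN, ?_, ?_⟩
  · intro v hv
    rcases mem_replaceOn.1 hv with h | h
    · exact hB h.1
    · exact hX h.1
  refine (cost_addCluster_le hw hW 𝒞 (B := B) (X := X) (X' := replaceOn B J X) ?_).trans ?_
  · intro v hv
    rw [mem_replaceOn]
    simp [hv]
  -- A wrongly omitted vertex has estimated gain at most the threshold `6W|N|/η`, hence true gain at
  -- most `8W|N|/η` plus the sampling error. A wrongly added vertex has positive estimated gain, so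
  -- its loss is at most `2W|N|/η` plus that error.
  have hterm : ∀ v ∈ B, ((if v ∈ X then moveGain G w 𝒞 B X v else 0) -
      if v ∈ replaceOn B J X then moveGain G w 𝒞 B X v else 0) ≤
      8 * W * N.card / η + |g * b ^ k / h * ∑ j, moveAffinity G w 𝒞 v (S j) -
        ∑ u ∈ Z, moveAffinity G w 𝒞 v u| := by
    intro v hv
    have hJ : v ∈ replaceOn B J X ↔ J v := by
      rw [mem_replaceOn]
      simp [hv]
    have hest := estCostStays_sub_estCostMoves G w 𝒞 hh0 S (g * b ^ k) v
    have habs := abs_le.1 (le_refl |g * b ^ k / h * ∑ j, moveAffinity G w 𝒞 v (S j) -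
        ∑ u ∈ Z, moveAffinity G w 𝒞 v u|)
    have hthr : 6 * (η : ℝ)⁻¹ * W * N.card + 2 * W * N.card / η = 8 * W * N.card / η := by
      field_simp
      ring
    have h2 : 0 ≤ 2 * W * N.card / η := by positivity
    have h6 : 0 ≤ 6 * (η : ℝ)⁻¹ * W * N.card := by positivity
    have h0 := abs_nonneg (g * b ^ k / h * ∑ j, moveAffinity G w 𝒞 v (S j) -
        ∑ u ∈ Z, moveAffinity G w 𝒞 v u)
    obtain ⟨hp, hn⟩ := hgain v hv
    rw [if_congr hJ rfl rfl]
    rcases lt_or_ge 0 (moveGain G w 𝒞 B X v) with hD | hD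
    · have hp := hp hD
      by_cases hj : J v
      · rw [if_pos hj]
        split_ifs <;> linarith
      · rw [if_neg hj]
        have hj' := not_lt.1 hj
        split_ifs <;> linarith
    · have hn := hn hD
      by_cases hj : J v
      · rw [if_pos hj]
        have hj' : estCostMoves G w S (g * b ^ k) v + 6 * (η : ℝ)⁻¹ * W * N.card <
          estCostStays G w 𝒞 S (g * b ^ k) v := hj
        split_ifs <;> linarith
      · rw [if_neg hj]
        split_ifs <;> linarith
  have hsum := Finset.sum_le_sum hterm
  rw [Finset.sum_add_distrib, Finset.sum_const, nsmul_eq_mul] at hsum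
  have hquad : W * (B.card * (B.card - 1)) / 2 ≤ B.card * (W * N.card / η) := by
    have h1 : (B.card : ℝ) - 1 ≤ N.card / η := by
      rw [le_div_iff₀ (by linarith)]
      linarith
    have h2 : W * B.card * (B.card - 1) ≤ W * B.card * (N.card / η) := by gcongr
    have h3 : W * B.card * (N.card / η) = B.card * (W * N.card / η) := by ring
    have h4 : (0 : ℝ) ≤ B.card * (W * N.card / η) := by positivity
    linarith
  -- The constant is `13 = 8 + 4 + 1`: threshold and slack, sampling error, pairs inside the batch.
  have hfin : (B.card : ℝ) * (8 * W * N.card / η) + B.card * (4 * W * N.card / η) +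
      B.card * (W * N.card / η) = B.card * (13 * W * N.card / η) := by ring
  linarith

end Batches

/-! ### One pivot: all batches together, and the best candidate -/

section Pivot

variable {V : Type u} [Fintype V] {G : SimpleGraph V} {w : Sym2 V → ℝ} {P : Preclustering V}

theorem Preclustering.self_mem_K (P : Preclustering V) (r : V) : r ∈ P.K r := by
  simp [Preclustering.K]

theorem Preclustering.N_nonempty (P : Preclustering V) (r : V) : (P.N r).Nonempty :=
  ⟨r, P.self_mem_N r⟩

theorem card_D_eq_sum_batches (P : Preclustering V) {η : ℕ} (batch : Clustering V → V → V → Fin η)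
    (𝒞 : Clustering V) (r : V) :
    ((P.D r).card : ℝ) = ∑ j, (((P.D r).filter (fun v => batch 𝒞 r v = j)).card : ℝ) := by
  exact_mod_cast Finset.card_eq_sum_card_fiberwise (f := batch 𝒞 r) (t := Finset.univ)
    (fun _ _ => Finset.mem_coe.2 (Finset.mem_univ _))

theorem mul_card_batch_sub_one_le {η : ℕ} {batch : Clustering V → V → V → Fin η}
    (hbatch : IsBatching P batch) (𝒞 : Clustering V) (r : V) (i : Fin η) :
    (η : ℝ) * (((P.D r).filter (fun v => batch 𝒞 r v = i)).card - 1) ≤ (P.D r).card := by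
  rw [card_D_eq_sum_batches P batch 𝒞 r]
  have h2 : (η : ℝ) * (((P.D r).filter (fun v => batch 𝒞 r v = i)).card - 1) =
      ∑ _j : Fin η, ((((P.D r).filter (fun v => batch 𝒞 r v = i)).card : ℝ) - 1) := by
    rw [Finset.sum_const, Finset.card_univ, Fintype.card_fin, nsmul_eq_mul]
  rw [h2]
  refine Finset.sum_le_sum fun j _ => ?_
  have : (((P.D r).filter (fun v => batch 𝒞 r v = i)).card : ℝ) ≤
      ((P.D r).filter (fun v => batch 𝒞 r v = j)).card + 1 := by exact_mod_cast hbatch 𝒞 r i j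
  linarith

/-- The proportion of successful sample sets guaranteed by the analysis of one pivot. -/
def sampleRate (η : ℕ) : ℝ := ((1 / (η : ℝ)) ^ η ^ 5 / 2) ^ η / (2 ^ η ^ 5) ^ η

theorem sampleRate_pos {η : ℕ} (hη : 0 < η) : 0 < sampleRate η := by
  have : (0 : ℝ) < η := by exact_mod_cast hη
  unfold sampleRate
  positivity

/-- The hybrid argument over all batches, started at `X = C`. The decisions for a batch depend only
on `𝒞` and on the sample and guess of that batch, so the successive replacements produce exactly an
output of `GenerateCluster`. The conditions on the size guesses say that they range from below
`|N(r)|/η` to above `|N(r)|`. -/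
theorem sampleRate_mul_card_le {p : Params} {batch : Clustering V → V → V → Fin p.η}
    (hw : IsWeight G w p.W) (hW : 1 ≤ p.W) (hη : 2 ≤ p.η) (hbatch : IsBatching P batch)
    (hs : 2 * p.η ^ 5 ≤ p.s) (𝒞 : Clustering V) {r : V} {C : Finset V} (hKC : P.K r ⊆ C)
    (hCN : C ⊆ P.N r) (hg : 0 < p.ε * G.degree r / 2)
    (hup : ((P.N r).card : ℝ) ≤ p.ε * G.degree r / 2 * (1 + 1 / (p.η : ℝ) ^ 2) ^ p.κ)
    (hlow : p.ε * G.degree r / 2 * (1 + 1 / (p.η : ℝ) ^ 2) ^ (-(p.κ : ℤ)) ≤ (P.N r).card / p.η) :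
    sampleRate p.η * (Fintype.piFinset fun _ : Fin p.η =>
        (P.N r).powersetCard (min p.s (P.N r).card)).card ≤
      (((Fintype.piFinset fun _ : Fin p.η =>
        (P.N r).powersetCard (min p.s (P.N r).card)).filter (fun T => ∃ x ∈ candidates p T,
          cost G w (tryCandidate G w P p batch 𝒞 r x) ≤ cost G w (addCluster 𝒞 C) +
            (P.D r).card * (13 * p.W * (P.N r).card / p.η))).card : ℝ) := by
  have hη' : (2 : ℝ) ≤ p.η := by exact_mod_cast hη
  set N := P.N r
  set h := p.η ^ 5 with hh
  set b : ℝ := 1 + 1 / (p.η : ℝ) ^ 2 with hbdef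
  set g : ℝ := p.ε * G.degree r / 2
  have hb : 1 < b := by
    have : 0 < 1 / (p.η : ℝ) ^ 2 := by positivity
    linarith
  have hbη : b - 1 ≤ 1 / p.η := by
    rw [hbdef, add_sub_cancel_left]
    refine one_div_le_one_div_of_le (by linarith) ?_
    nlinarith
  have hN0 : 0 < N.card := (P.N_nonempty r).card_pos
  have hNR : (0 : ℝ) < N.card := by exact_mod_cast hN0
  have hh0 : 0 < h := by rw [hh]; positivity
  set B : Fin p.η → Finset V := fun i => (P.D r).filter (fun v => batch 𝒞 r v = i) with hB
  have hBdisj : ∀ i j, i ≠ j → Disjoint (B i) (B j) := by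
    intro i j hij
    refine Finset.disjoint_left.2 fun v hv hv' => hij ?_
    exact (Finset.mem_filter.1 hv).2.symm.trans (Finset.mem_filter.1 hv').2
  have hDN : P.D r ⊆ N := Finset.sdiff_subset
  have hBN : ∀ i, B i ⊆ N := fun i => (Finset.filter_subset _ _).trans hDN
  have hDcard : ((P.D r).card : ℝ) ≤ N.card := by exact_mod_cast Finset.card_le_card hDN
  set J : Fin p.η → (Fin h → V) → ℤ → V → Prop := fun _ S k v =>
    estCostMoves G w S (g * b ^ k) v + 6 * (p.η : ℝ)⁻¹ * p.W * N.card <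
      estCostStays G w 𝒞 S (g * b ^ k) v with hJ
  set Y := Fintype.piFinset (fun _ : Fin h => N) with hY
  have hYcard : (Y.card : ℝ) = (N.card : ℝ) ^ h := by simp [hY]
  set rate : ℝ := (1 / (p.η : ℝ)) ^ h / 2 with hrate
  set 𝒮 := (Fintype.piFinset fun _ : Fin p.η => Y).filter (fun S =>
        ∃ k : Fin p.η → ℤ, (∀ i, k i ∈ Finset.Icc (-(p.κ : ℤ)) p.κ) ∧
          cost G w (addCluster 𝒞 (Finset.univ.filter (fun v =>
            (∃ i, v ∈ B i ∧ J i (S i) (k i) v) ∨ (v ∈ C ∧ ∀ i, v ∉ B i)))) ≤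
          cost G w (addCluster 𝒞 C) + ∑ i, ((B i).card * (13 * p.W * N.card / p.η))) with h𝒮
  have hseq : (rate * Y.card) ^ p.η ≤ (𝒮.card : ℝ) := by
    refine pow_mul_card_le_card_sequences Y (Finset.Icc (-(p.κ : ℤ)) p.κ)
      (p := rate) (by positivity) (fun X => cost G w (addCluster 𝒞 X)) (fun X => X ⊆ N) p.η B J
      (fun i => (B i).card * (13 * p.W * N.card / p.η)) hBdisj ?_ C hCN
    intro i x hx
    obtain ⟨k, hk, hcard⟩ := exists_guess_card_filter_batch hw hW 𝒞 hx (hBN i) hη hh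
      ((mul_card_batch_sub_one_le hbatch 𝒞 r i).trans hDcard) hg hb hbη hup hlow
    refine ⟨k, hk, ?_⟩
    rw [hYcard]
    refine hcard.trans (le_of_eq ?_)
    congr!
  have hsumB : ∑ i, ((B i).card * (13 * p.W * N.card / p.η) : ℝ) =
      (P.D r).card * (13 * p.W * N.card / p.η) := by
    rw [← Finset.sum_mul, card_D_eq_sum_batches P batch 𝒞 r]
  have hgen : ∀ (S : Fin p.η → Fin h → V) (k : Fin p.η → ℤ),
      (Finset.univ.filter (fun v =>
            (∃ i, v ∈ B i ∧ J i (S i) (k i) v) ∨ (v ∈ C ∧ ∀ i, v ∉ B i))) =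
      generateCluster G w P p batch 𝒞 r S (fun i => sizeGuess G p r (k i)) := by
    intro S k
    ext v
    have hvB : ∀ i, v ∈ B i ↔ v ∈ P.D r ∧ batch 𝒞 r v = i := fun i => Finset.mem_filter
    have hvD : v ∈ P.D r ↔ v ∈ N ∧ v ∉ P.K r := Finset.mem_sdiff
    simp only [generateCluster, Finset.mem_filter, Finset.mem_univ, true_and, Finset.mem_union,
      hvB]
    have e1 : (∃ i, (v ∈ P.D r ∧ batch 𝒞 r v = i) ∧ J i (S i) (k i) v) ↔
        v ∈ P.D r ∧ J (batch 𝒞 r v) (S (batch 𝒞 r v)) (k (batch 𝒞 r v)) v := by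
      constructor
      · rintro ⟨i, ⟨hv, rfl⟩, hj⟩
        exact ⟨hv, hj⟩
      · rintro ⟨hv, hj⟩
        exact ⟨_, ⟨hv, rfl⟩, hj⟩
    -- The batches cover `D(r)`, and `K(r) ⊆ C ⊆ N(r)`, so the part of `C` that no batch touches is
    -- exactly `K(r)`.
    have e2 : (v ∈ C ∧ ∀ i, ¬ (v ∈ P.D r ∧ batch 𝒞 r v = i)) ↔ v ∈ P.K r := by
      constructor
      · rintro ⟨hv, hn⟩
        by_contra hK
        exact hn _ ⟨hvD.2 ⟨hCN hv, hK⟩, rfl⟩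
      · exact fun hK => ⟨hKC hK, fun i hi => (hvD.1 hi.1).2 hK⟩
    rw [e1, e2, or_comm]
    rfl
  set m := min p.s N.card with hm
  have hm0 : 0 < m := lt_min (by omega) hN0
  have hcount := card_mul_le_card_subsets_containing hm0 (min_le_right _ _)
    (show 2 * h ≤ m ∨ m = N.card by
      rcases le_total p.s N.card with hle | hle
      · left
        rw [hm, min_eq_left hle]
        exact hs
      · right
        exact min_eq_right hle) 𝒮 (by
      intro S hS i j
      have := Fintype.mem_piFinset.1 (Finset.mem_filter.1 hS).1 i
      exact Fintype.mem_piFinset.1 this j)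
  have hsub : (((Fintype.piFinset fun _ : Fin p.η => N.powersetCard m).filter
        (fun T => ∃ S ∈ 𝒮, ∀ i j, S i j ∈ T i)).card : ℝ) ≤
      (((Fintype.piFinset fun _ : Fin p.η => N.powersetCard m).filter
        (fun T => ∃ x ∈ candidates p T,
          cost G w (tryCandidate G w P p batch 𝒞 r x) ≤ cost G w (addCluster 𝒞 C) +
            (P.D r).card * (13 * p.W * N.card / p.η))).card : ℝ) := by
    norm_cast
    refine Finset.card_le_card fun T hT => ?_
    rw [Finset.mem_filter] at hT ⊢
    refine ⟨hT.1, ?_⟩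
    obtain ⟨S, hS, hST⟩ := hT.2
    obtain ⟨k, hk, hcost⟩ := (Finset.mem_filter.1 hS).2
    refine ⟨(S, k), ?_, ?_⟩
    · simp only [candidates, Finset.mem_product, Fintype.mem_piFinset]
      exact ⟨hST, hk⟩
    · rw [hsumB, hgen] at hcost
      exact hcost
  have hΩ : ((Fintype.piFinset fun _ : Fin p.η => N.powersetCard m).card : ℝ) =
      (N.card.choose m : ℝ) ^ p.η := by
    simp
  rw [hΩ]
  refine le_trans ?_ hsub
  have hpos : (0 : ℝ) < ((2 * N.card : ℝ) ^ h) ^ p.η := by positivity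
  refine le_of_mul_le_mul_left ?_ hpos
  refine le_trans ?_ hcount
  -- The powers of `|N|` cancel, which makes `sampleRate` independent of `n`.
  calc ((2 * N.card : ℝ) ^ h) ^ p.η * (sampleRate p.η * (N.card.choose m : ℝ) ^ p.η)
      = (rate * Y.card) ^ p.η * (N.card.choose m : ℝ) ^ p.η := by
        rw [hYcard, sampleRate, ← hh, ← hrate, mul_pow (2 : ℝ), mul_pow (2 ^ h : ℝ), mul_pow rate]
        field_simp
    _ ≤ _ := by gcongr

variable (p : Params) (batch : Clustering V → V → V → Fin p.η)

theorem cost_pivotStep_lt {𝒞 : Clustering V} {r : V} {T : Fin p.η → Finset V}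
    (hpos : 0 < p.γ * P.numAdm / Fintype.card V)
    (h : ∃ x ∈ candidates p T, cost G w (tryCandidate G w P p batch 𝒞 r x) ≤
      cost G w 𝒞 - p.γ * P.numAdm / Fintype.card V) :
    cost G w (pivotStep G w P p batch 𝒞 r T) < cost G w 𝒞 := by
  obtain ⟨x, hx, hcost⟩ := h
  have hne : (candidates p T).Nonempty := ⟨x, hx⟩
  have hmin := (Finset.exists_min_image (candidates p T)
    (fun x => cost G w (tryCandidate G w P p batch 𝒞 r x)) hne).choose_spec.2 x hx
  unfold pivotStep
  rw [dif_pos hne]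
  simp only
  rw [if_pos (hmin.trans hcost)]
  linarith [hmin.trans hcost]

theorem pivotStep_eq_or_cost_le (𝒞 : Clustering V) (r : V) (T : Fin p.η → Finset V) :
    pivotStep G w P p batch 𝒞 r T = 𝒞 ∨ cost G w (pivotStep G w P p batch 𝒞 r T) ≤
      cost G w 𝒞 - p.γ * P.numAdm / Fintype.card V := by
  unfold pivotStep
  split_ifs with h
  · simp only
    split_ifs with h2
    · exact Or.inr h2
    · exact Or.inl rfl
  · exact Or.inl rfl

end Pivot

theorem Preclustering.sameAtom_iff {V : Type u} {P : Preclustering V} {K : Finset V} (hK : K ∈ P.atoms) {u v : V} (hu : u ∈ K) :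
    P.SameAtom u v ↔ v ∈ K := by
  constructor
  · rintro ⟨L, hL, huL, hvL⟩
    by_contra hv
    refine Finset.disjoint_left.1 (P.atom_disjoint L hL K hK ?_) huL hu
    rintro rfl
    exact hv hvL
  · exact fun hv => ⟨K, hK, hu, hv⟩

theorem degIn_le_card {V : Type u} (G : SimpleGraph V) (v : V) (S : Finset V) : degIn G v S ≤ S.card := by
  unfold degIn
  exact_mod_cast Finset.card_filter_le _ _

/-! ### Clusters of the split optimum and their pivots -/

section Targets

variable {V : Type u} [Fintype V] {G : SimpleGraph V} {P : Preclustering V}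

namespace Preclustering

theorem K_eq_of_mem {K : Finset V} (hK : K ∈ P.atoms) {r : V} (hr : r ∈ K) : P.K r = K := by
  ext v
  simp only [Preclustering.K, Finset.mem_filter, Finset.mem_univ, true_and, sameAtom_iff hK hr]
  exact ⟨fun h => h.elim (fun h => h ▸ hr) id, Or.inr⟩

theorem K_eq_singleton {r : V} (hr : ¬ P.InAtom r) : P.K r = {r} := by
  ext v
  simp only [Preclustering.K, Finset.mem_filter, Finset.mem_univ, true_and, Finset.mem_singleton]
  refine ⟨fun h => h.elim id ?_, Or.inl⟩
  rintro ⟨L, hL, hrL, _⟩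
  exact absurd ⟨L, hL, hrL⟩ hr

theorem K_subset_N (r : V) : P.K r ⊆ P.N r := by
  by_cases hr : P.InAtom r
  · rw [N, if_pos hr]
    exact Finset.subset_union_left
  · rw [K_eq_singleton hr]
    exact Finset.singleton_subset_iff.2 (P.self_mem_N r)

theorem card_N (r : V) : (P.N r).card = (P.K r).card + (P.D r).card := by
  have := Finset.card_sdiff_add_card_eq_card (K_subset_N (P := P) r)
  rw [D]
  omega

theorem adj_of_mem_D {r x : V} (hx : x ∈ P.D r) : ∀ u ∈ P.K r, P.adm.Adj u x := by
  intro u hu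
  rw [D, Finset.mem_sdiff] at hx
  obtain ⟨hxN, hxK⟩ := hx
  have hux : x ≠ u := by
    rintro rfl
    exact hxK hu
  by_cases hr : P.InAtom r
  · rw [N, if_pos hr, Finset.mem_union] at hxN
    have h1 := (Finset.mem_filter.1 (hxN.resolve_left hxK)).2 u hu
    exact (Finset.mem_filter.1 h1).2.resolve_left hux
  · rw [K_eq_singleton hr, Finset.mem_singleton] at hu
    subst hu
    rw [N, if_neg hr, Finset.mem_filter] at hxN
    exact (Finset.mem_filter.1 hxN.1).2.resolve_left hux

/-- Having the bound at every `u ∈ K(r)`, and not only at `r`, permits summing over an atom: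
`|D(r)||K(r)|` is at most the total admissible degree of the atom. -/
theorem card_D_le_degree {r u : V} (hu : u ∈ P.K r) : (P.D r).card ≤ P.adm.degree u := by
  rw [← SimpleGraph.card_neighborFinset_eq_degree]
  refine Finset.card_le_card fun x hx => ?_
  rw [SimpleGraph.mem_neighborFinset]
  exact adj_of_mem_D hx u hu

/-- The clusters of the split optimum: either an atom together with vertices admissible to all of
it, or a large set of pairwise admissible vertices outside all atoms. -/
def IsTarget (P : Preclustering V) (G : SimpleGraph V) (ε : ℝ) (C : Finset V) : Prop :=
  (∃ K ∈ P.atoms, K ⊆ C ∧ ∀ x ∈ C, x ∉ K → ∀ u ∈ K, P.adm.Adj u x) ∨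
    ((∀ x ∈ C, ¬ P.InAtom x) ∧ (∀ x ∈ C, ∀ y ∈ C, x ≠ y → P.adm.Adj x y) ∧
      (1 < C.card → ∀ v ∈ C, ε / 2 * G.degree v ≤ C.card))

/-- A vertex admissible to a member of an atom lies outside all atoms, so a good cluster contains at
most one atom and `C ∖ K` meets none. The split atom has less than half of its cluster, so the
remainder keeps the size bound with `ε/2` in place of `ε`. -/
theorem isTarget_of_mem_split {ε : ℝ} (hε : 0 < ε) (hε1 : ε ≤ 1) {Opt : Clustering V}
    (hOpt : P.IsGoodClustering G ε Opt) {C : Finset V} (hC : C ∈ (P.split ε Opt).parts) :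
    P.IsTarget G ε C := by
  rw [split, Finpartition.mem_bind] at hC
  obtain ⟨C₀, hC₀, hC⟩ := hC
  obtain ⟨hbreak, hadm, hsize⟩ := hOpt C₀ hC₀
  have hadj : ∀ K ∈ P.atoms, K ⊆ C₀ → ∀ x ∈ C₀, x ∉ K → ∀ u ∈ K, P.adm.Adj u x := by
    intro K hK hKC x hx hxK u hu
    refine (hadm u (hKC hu) x hx ?_).resolve_left ?_
    · rintro rfl
      exact hxK hu
    · rwa [sameAtom_iff hK hu]
  split_ifs at hC with h
  · set K := h.choose
    obtain ⟨hK, hKC, hKcard⟩ := h.choose_spec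
    rcases Finpartition.mem_parts_or_eq_sdiff_of_mem_extendOfLE _ _ hC with h1 | h1
    · have h1 : C = K := by simpa [Finpartition.indiscrete] using h1
      rw [h1]
      exact Or.inl ⟨K, hK, subset_rfl, fun x hx hx' => absurd hx hx'⟩
    · subst h1
      obtain ⟨u, hu⟩ := P.atom_nonempty K hK
      refine Or.inr ⟨?_, ?_, ?_⟩
      · intro x hx hxA
        rw [Finset.mem_sdiff] at hx
        exact P.adm_not_both u x (hadj K hK hKC x hx.1 hx.2 u hu) ⟨⟨K, hK, hu⟩, hxA⟩
      · intro x hx y hy hxy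
        rw [Finset.mem_sdiff] at hx hy
        refine (hadm x hx.1 y hy.1 hxy).resolve_left ?_
        rintro ⟨L, hL, hxL, _⟩
        exact P.adm_not_both u x (hadj K hK hKC x hx.1 hx.2 u hu) ⟨⟨K, hK, hu⟩, ⟨L, hL, hxL⟩⟩
      · intro hcard v hv
        have hle : (C₀ \ K).card ≤ C₀.card := Finset.card_le_card Finset.sdiff_subset
        have h2 := hsize v (Finset.mem_sdiff.1 hv).1 (hcard.trans_le hle)
        have h3 : ((C₀ \ K).card : ℝ) = C₀.card - K.card := by
          rw [Finset.card_sdiff_of_subset hKC, Nat.cast_sub (Finset.card_le_card hKC)]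
        have h4 : ε ^ 21 / 576 * (C₀.card : ℝ) ≤ 1 / 2 * C₀.card := by
          have : ε ^ 21 ≤ 1 := pow_le_one₀ hε.le hε1
          exact mul_le_mul_of_nonneg_right (by linarith) (by positivity)
        change ε / 2 * (G.degree v : ℝ) ≤ ((C₀ \ K).card : ℝ)
        rw [h3]
        change (K.card : ℝ) < _ at hKcard
        linarith
  · have h1 : C = C₀ := by simpa [Finpartition.indiscrete] using hC
    subst h1
    by_cases hA : ∃ x ∈ C, P.InAtom x
    · obtain ⟨x, hx, K, hK, hxK⟩ := hA
      have hKC : K ⊆ C := fun v hv => hbreak x hx v ⟨K, hK, hxK, hv⟩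
      exact Or.inl ⟨K, hK, hKC, hadj K hK hKC⟩
    · push Not at hA
      refine Or.inr ⟨hA, ?_, ?_⟩
      · intro x hx y hy hxy
        refine (hadm x hx y hy hxy).resolve_left ?_
        rintro ⟨L, hL, hxL, _⟩
        exact hA x hx ⟨L, hL, hxL⟩
      · intro hcard v hv
        have h2 := hsize v hv hcard
        have : 0 ≤ ε * (G.degree v : ℝ) := by positivity
        linarith

end Preclustering

theorem degIn_add_degIn_sdiff (G : SimpleGraph V) (v : V) (S : Finset V) :
    degIn G v S + degIn G v (Finset.univ \ S) = G.degree v := by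
  unfold degIn
  rw [← SimpleGraph.card_neighborFinset_eq_degree]
  norm_cast
  rw [← Finset.card_union_of_disjoint
    (Finset.disjoint_filter_filter Finset.disjoint_sdiff), ← Finset.filter_union,
    Finset.union_sdiff_of_subset (Finset.subset_univ S)]
  congr 1
  ext u
  simp

/-- In every target cluster that is not a singleton there are many pivots from whose neighborhood the
cluster can be found. -/
theorem Preclustering.IsTarget.exists_pivots {A ε : ℝ} (hε : 0 < ε) (hε1 : ε ≤ 1)
    (hA : A * ε ≤ 1 / 4) (hgood : P.IsGood G A ε) {C : Finset V} (hC : P.IsTarget G ε C)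
    (hcard : 1 < C.card) :
    ∃ Q ⊆ C, Q.Nonempty ∧ ∀ r ∈ Q, P.K r ⊆ C ∧ C ⊆ P.N r ∧ 0 < G.degree r ∧
      ε / 2 * G.degree r ≤ Q.card ∧
      ((P.D r).card * (P.N r).card : ℝ) ≤ 100 * (ε⁻¹) ^ 8 * P.admDeg C ∧
      ε / 2 * G.degree r ≤ (P.N r).card ∧ ((P.N r).card : ℝ) ≤ 20 * (ε⁻¹) ^ 3 * G.degree r := by
  obtain ⟨hdeg, -, hatom⟩ := hgood
  set e := ε⁻¹ with he
  have he1 : 1 ≤ e := (one_le_inv₀ hε).2 hε1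
  have hee : ε * e = 1 := mul_inv_cancel₀ hε.ne'
  have hdeg' : ∀ v, (P.adm.degree v : ℝ) ≤ 2 * e ^ 3 * G.degree v := by
    intro v
    rw [he, inv_pow]
    exact hdeg v
  have he3 : 1 ≤ e ^ 3 := one_le_pow₀ he1
  have hadm_pos : ∀ r x, P.adm.Adj r x → 0 < G.degree r := by
    intro r x hrx
    have h1 : 0 < P.adm.degree r := (P.adm.degree_pos_iff_exists_adj r).2 ⟨x, hrx⟩
    by_contra h0
    have h2 : G.degree r = 0 := by omega
    have h3 := hdeg' r
    rw [h2] at h3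
    have : (0 : ℝ) < P.adm.degree r := by exact_mod_cast h1
    simp at h3
    linarith
  rcases hC with ⟨K, hK, hKC, hadj⟩ | ⟨hno, hadj, hsize⟩
  -- In a target containing an atom, the pivots are the vertices of the atom: their degrees are
  -- comparable to `|K|`, however large `C` is.
  · refine ⟨K, hKC, P.atom_nonempty K hK, fun r hr => ?_⟩
    have hKr : P.K r = K := P.K_eq_of_mem hK hr
    obtain ⟨hin, hout⟩ := hatom K hK r hr
    have hKpos : (1 : ℝ) ≤ K.card := by exact_mod_cast Finset.card_pos.2 ⟨r, hr⟩
    have hsum := degIn_add_degIn_sdiff G r K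
    have hinle := degIn_le_card G r K
    have hAK : A * ε * K.card ≤ 1 / 4 * K.card := by gcongr
    have hout0 : 0 ≤ degIn G r (Finset.univ \ K) := by unfold degIn; positivity
    have hd_le : (G.degree r : ℝ) ≤ 2 * K.card := by linarith
    -- For a one-vertex atom the adjacency condition says nothing, because a vertex counts as
    -- adjacent to itself. Then `C` has a further vertex, which is admissible to `r`, and `d^adm(r)
    -- ≤ 2ε^(-3) d(r)` excludes degree `0`.
    have hd_pos : 0 < G.degree r := by
      rcases Nat.lt_or_ge 1 K.card with h1 | h1
      · have h2 : (2 : ℝ) ≤ K.card := by exact_mod_cast h1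
        have h3 : (0 : ℝ) < G.degree r := by linarith
        exact_mod_cast h3
      · have : ∃ x ∈ C, x ∉ K := by
          by_contra hcon
          push Not at hcon
          have := Finset.card_le_card (show C ⊆ K from hcon)
          omega
        obtain ⟨x, hx, hxK⟩ := this
        exact hadm_pos r x (hadj x hx hxK r hr)
    have hd1 : (1 : ℝ) ≤ G.degree r := by exact_mod_cast hd_pos
    have hK_le : (K.card : ℝ) ≤ 4 * G.degree r := by linarith
    have hD_le : ((P.D r).card : ℝ) ≤ 2 * e ^ 3 * G.degree r := by
      have h1 : ((P.D r).card : ℝ) ≤ P.adm.degree r := by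
        exact_mod_cast P.card_D_le_degree (P.self_mem_K r)
      exact h1.trans (hdeg' r)
    have hNcard : ((P.N r).card : ℝ) = K.card + (P.D r).card := by
      rw [P.card_N, hKr]
      push_cast
      ring
    have hDK : (P.D r).card * K.card ≤ P.admDeg C := by
      calc (P.D r).card * K.card = ∑ u ∈ K, (P.D r).card := by
            rw [Finset.sum_const, smul_eq_mul, mul_comm]
        _ ≤ ∑ u ∈ K, P.adm.degree u :=
            Finset.sum_le_sum fun u hu => P.card_D_le_degree (by rwa [hKr])
        _ ≤ P.admDeg C := Finset.sum_le_sum_of_subset hKC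
    have hDK' : ((P.D r).card : ℝ) * K.card ≤ P.admDeg C := by exact_mod_cast hDK
    have hN_le : ((P.N r).card : ℝ) ≤ 5 * e ^ 3 * K.card := by
      have h1 : 2 * e ^ 3 * (G.degree r : ℝ) ≤ 2 * e ^ 3 * (2 * K.card) := by gcongr
      have h2 : (K.card : ℝ) ≤ e ^ 3 * K.card := by nlinarith
      linarith
    refine ⟨hKr ▸ hKC, ?_, hd_pos, ?_, ?_, ?_, ?_⟩
    · intro x hx
      rw [Preclustering.N, if_pos ⟨K, hK, hr⟩, hKr, Finset.mem_union]
      by_cases hxK : x ∈ K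
      · exact Or.inl hxK
      · refine Or.inr (Finset.mem_filter.2 ⟨Finset.mem_univ x, fun u hu => ?_⟩)
        exact Finset.mem_filter.2 ⟨Finset.mem_univ x, Or.inr (hadj x hx hxK u hu)⟩
    · nlinarith
    · calc ((P.D r).card * (P.N r).card : ℝ) ≤ (P.D r).card * (5 * e ^ 3 * K.card) := by gcongr
        _ = 5 * e ^ 3 * ((P.D r).card * K.card) := by ring
        _ ≤ 100 * e ^ 8 * P.admDeg C := by
            have : e ^ 3 ≤ e ^ 8 := pow_le_pow_right₀ he1 (by norm_num)
            gcongr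
            linarith
    · rw [hNcard]
      have : (0 : ℝ) ≤ (P.D r).card := by positivity
      nlinarith
    · calc ((P.N r).card : ℝ) ≤ 5 * e ^ 3 * K.card := hN_le
        _ ≤ 5 * e ^ 3 * (4 * G.degree r) := by gcongr
        _ = _ := by ring
  -- In a target without atoms every vertex is a pivot, and `d(r) ≤ 2ε⁻¹|C|` bounds both `|D(r)|`
  -- and `|N(r)|` by multiples of `|C|`.
  · refine ⟨C, subset_rfl, Finset.card_pos.1 (by omega), fun r hr => ?_⟩
    have hrA := hno r hr
    have hKr : P.K r = {r} := P.K_eq_singleton hrA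
    have hC2 : (2 : ℝ) ≤ C.card := by exact_mod_cast hcard
    have hCN : C ⊆ P.N r := by
      intro x hx
      rw [Preclustering.N, if_neg hrA, Finset.mem_filter]
      refine ⟨Finset.mem_filter.2 ⟨Finset.mem_univ x, ?_⟩, hno x hx⟩
      by_cases hxr : x = r
      · exact Or.inl hxr
      · exact Or.inr (hadj r hr x hx (Ne.symm hxr))
    have hsz := hsize hcard r hr
    have hd_pos : 0 < G.degree r := by
      obtain ⟨x, hx, hxr⟩ := Finset.exists_mem_ne hcard r
      exact hadm_pos r x (hadj r hr x hx (Ne.symm hxr))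
    have hd1 : (1 : ℝ) ≤ G.degree r := by exact_mod_cast hd_pos
    have hD_le : ((P.D r).card : ℝ) ≤ 2 * e ^ 3 * G.degree r := by
      have h1 : ((P.D r).card : ℝ) ≤ P.adm.degree r := by
        exact_mod_cast P.card_D_le_degree (P.self_mem_K r)
      exact h1.trans (hdeg' r)
    have hNcard : ((P.N r).card : ℝ) = 1 + (P.D r).card := by
      rw [P.card_N, hKr]
      push_cast
      simp
    have hCN' : (C.card : ℝ) ≤ (P.N r).card := by exact_mod_cast Finset.card_le_card hCN
    have hdC : (G.degree r : ℝ) ≤ 2 * e * C.card := by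
      calc (G.degree r : ℝ) = 2 * e * (ε / 2 * G.degree r) := by
            linear_combination (-(G.degree r : ℝ)) * hee
        _ ≤ _ := by gcongr
    have hDC : ((P.D r).card : ℝ) ≤ 4 * e ^ 4 * C.card := by
      calc ((P.D r).card : ℝ) ≤ 2 * e ^ 3 * (2 * e * C.card) := hD_le.trans (by gcongr)
        _ = _ := by ring
    have he4 : 1 ≤ e ^ 4 := one_le_pow₀ he1
    have hNC : ((P.N r).card : ℝ) ≤ 5 * e ^ 4 * C.card := by
      have : 1 ≤ e ^ 4 * C.card := by nlinarith
      linarith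
    have hadmC : (C.card : ℝ) * (C.card - 1) ≤ P.admDeg C := by
      have h1 : C.card * (C.card - 1) ≤ P.admDeg C := by
        calc C.card * (C.card - 1) = ∑ u ∈ C, (C.card - 1) := by
              rw [Finset.sum_const, smul_eq_mul]
          _ ≤ ∑ u ∈ C, P.adm.degree u := by
              refine Finset.sum_le_sum fun u hu => ?_
              rw [← Finset.card_erase_of_mem hu, ← SimpleGraph.card_neighborFinset_eq_degree]
              refine Finset.card_le_card fun x hx => ?_
              rw [SimpleGraph.mem_neighborFinset]
              rw [Finset.mem_erase] at hx
              exact hadj u hu x hx.2 hx.1.symm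
      have h2 : ((C.card - 1 : ℕ) : ℝ) = C.card - 1 := by
        rw [Nat.cast_sub (by omega), Nat.cast_one]
      rw [← h2]
      exact_mod_cast h1
    refine ⟨?_, hCN, hd_pos, hsz, ?_, hsz.trans hCN', ?_⟩
    · rw [hKr]
      exact Finset.singleton_subset_iff.2 hr
    · calc ((P.D r).card * (P.N r).card : ℝ) ≤ (4 * e ^ 4 * C.card) * (5 * e ^ 4 * C.card) := by
            gcongr
        _ = 20 * e ^ 8 * (C.card * C.card) := by ring
        -- `|C| ≥ 2` allows `|C|²` to be replaced by `2|C|(|C| - 1)`, which pairwise admissibility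
        -- bounds by twice the admissible degree of `C`.
        _ ≤ 20 * e ^ 8 * (2 * (C.card * (C.card - 1))) := by
            refine mul_le_mul_of_nonneg_left ?_ (by positivity)
            nlinarith
        _ ≤ 20 * e ^ 8 * (2 * P.admDeg C) := by gcongr
        _ ≤ _ := by
            have : 0 ≤ e ^ 8 * (P.admDeg C : ℝ) := by positivity
            linarith
    · have : 1 ≤ e ^ 3 * (G.degree r : ℝ) := by nlinarith
      linarith

theorem Preclustering.mem_initial_parts {C : Finset V} :
    C ∈ P.initial.parts ↔ C ∈ P.atoms ∨ ∃ v, ¬ P.InAtom v ∧ {v} = C := by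
  change C ∈ P.atoms ∪ _ ↔ _
  simp

theorem Preclustering.IsTarget.mem_initial_parts {ε : ℝ} (hadm : ∀ u v, ¬ P.adm.Adj u v)
    {C : Finset V} (hC : P.IsTarget G ε C) (hne : C.Nonempty) : C ∈ P.initial.parts := by
  rw [Preclustering.mem_initial_parts]
  rcases hC with ⟨K, hK, hKC, hadj⟩ | ⟨hno, hadj, -⟩
  · left
    have : C = K := by
      refine Finset.Subset.antisymm (fun x hx => ?_) hKC
      by_contra hxK
      obtain ⟨u, hu⟩ := P.atom_nonempty K hK
      exact hadm u x (hadj x hx hxK u hu)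
    rwa [this]
  · right
    obtain ⟨v, hv⟩ := hne
    refine ⟨v, hno v hv, (Finset.eq_singleton_iff_unique_mem.2 ⟨hv, fun x hx => ?_⟩).symm⟩
    by_contra hxv
    exact hadm x v (hadj x hx v hv hxv)

theorem Preclustering.sum_admDeg (P : Preclustering V) (𝒞 : Clustering V) :
    ∑ C ∈ 𝒞.parts, P.admDeg C = 2 * P.numAdm := by
  unfold Preclustering.admDeg Preclustering.numAdm
  rw [← SimpleGraph.sum_degrees_eq_twice_card_edges]
  have h := Finset.sum_biUnion (f := fun u => P.adm.degree u) (t := id) 𝒞.disjoint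
  rw [𝒞.biUnion_parts] at h
  exact h.symm

/-- A clustering which is not locally optimal can be improved a lot by some cluster. -/
theorem exists_improving_cluster {w : Sym2 V → ℝ} {γ : ℝ} (hγ : 0 < γ) (𝒪 𝒞 : Clustering V)
    (h : ¬ P.IsGoodLocalOpt G w (3 / 2 * γ) 𝒪 𝒞) :
    ∃ C ∈ 𝒪.parts, cost G w (addCluster 𝒞 C) + γ * P.admDeg C ≤
      cost G w 𝒞 - γ * P.numAdm / Fintype.card V := by
  by_contra hcon
  push Not at hcon
  apply h
  unfold Preclustering.IsGoodLocalOpt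
  -- Averaging: the admissible degrees sum to `2|E_adm|` and there are at most `n` clusters, so the
  -- assumed bounds add up to `2γ|E_adm| + γ|E_adm|`, the total allowed for a `3γ/2`-good local
  -- optimum.
  have hsum : ∑ C ∈ 𝒪.parts, (cost G w 𝒞 - cost G w (addCluster 𝒞 C)) ≤
      ∑ C ∈ 𝒪.parts, (γ * P.admDeg C + γ * P.numAdm / Fintype.card V) :=
    Finset.sum_le_sum fun C hC => by linarith [hcon C hC]
  refine hsum.trans ?_
  rw [Finset.sum_add_distrib, ← Finset.mul_sum, Finset.sum_const, nsmul_eq_mul]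
  have h1 : ∑ C ∈ 𝒪.parts, (P.admDeg C : ℝ) = 2 * P.numAdm := by
    exact_mod_cast P.sum_admDeg 𝒪
  have h2 : (𝒪.parts.card : ℝ) ≤ Fintype.card V := by exact_mod_cast 𝒪.card_parts_le_card
  have h3 : (𝒪.parts.card : ℝ) * (γ * P.numAdm / Fintype.card V) ≤ γ * P.numAdm := by
    calc (𝒪.parts.card : ℝ) * (γ * P.numAdm / Fintype.card V)
        = γ * P.numAdm * (𝒪.parts.card / Fintype.card V) := by ring
      _ ≤ γ * P.numAdm * 1 := by
          gcongr
          exact div_le_one_of_le₀ h2 (by positivity)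
      _ = _ := mul_one _
  rw [h1]
  linarith

end Targets

/-! ### Expectations and probabilities of discrete laws -/

section Expectation

open scoped ENNReal

variable {α β : Type*}

/-- The expectation of a nonnegative function. -/
def expect (p : PMF α) (f : α → ℝ≥0∞) : ℝ≥0∞ := ∑' a, p a * f a

theorem expect_bind (p : PMF α) (q : α → PMF β) (f : β → ℝ≥0∞) :
    expect (p.bind q) f = expect p fun a => expect (q a) f := by
  unfold expect
  simp_rw [PMF.bind_apply, ← ENNReal.tsum_mul_right, ← ENNReal.tsum_mul_left]
  rw [ENNReal.tsum_comm]
  simp_rw [mul_assoc]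

theorem expect_pure (a : α) (f : α → ℝ≥0∞) : expect (PMF.pure a) f = f a := by
  unfold expect
  rw [tsum_eq_single a]
  · simp
  · intro b hb
    simp [hb]

theorem expect_map (p : PMF α) (g : α → β) (f : β → ℝ≥0∞) :
    expect (p.map g) f = expect p (f ∘ g) := by
  rw [PMF.map, expect_bind]
  simp only [Function.comp_apply, expect_pure]
  rfl

theorem expect_mono_support {p : PMF α} {f g : α → ℝ≥0∞} (h : ∀ a ∈ p.support, f a ≤ g a) :
    expect p f ≤ expect p g := by
  refine ENNReal.tsum_le_tsum fun a => ?_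
  by_cases ha : a ∈ p.support
  · gcongr
    exact h a ha
  · rw [PMF.apply_eq_zero_iff p a |>.2 ha]
    simp

theorem expect_const_add_indicator [DecidableEq α] (p : PMF α) (a : α) (c d : ℝ≥0∞) :
    expect p (fun b => c + if b = a then d else 0) = c + p a * d := by
  unfold expect
  simp_rw [mul_add]
  rw [ENNReal.tsum_add, ENNReal.tsum_mul_right, p.tsum_coe, one_mul]
  congr 1
  rw [tsum_eq_single a]
  · simp
  · intro b hb
    simp [hb]

theorem toOuterMeasure_le_expect {p : PMF α} {s : Set α} {f : α → ℝ≥0∞}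
    (h : ∀ a ∈ p.support, a ∈ s → 1 ≤ f a) : p.toOuterMeasure s ≤ expect p f := by
  rw [PMF.toOuterMeasure_apply]
  refine ENNReal.tsum_le_tsum fun a => ?_
  by_cases ha : a ∈ s
  · rw [Set.indicator_of_mem ha]
    by_cases hs : a ∈ p.support
    · exact le_mul_of_one_le_right' (h a hs ha)
    · rw [PMF.apply_eq_zero_iff p a |>.2 hs]
      simp
  · rw [Set.indicator_of_notMem ha]
    exact zero_le

theorem toOuterMeasure_add_compl (p : PMF α) (s : Set α) :
    p.toOuterMeasure s + p.toOuterMeasure sᶜ = 1 := by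
  rw [PMF.toOuterMeasure_apply, PMF.toOuterMeasure_apply, ← ENNReal.tsum_add, ← p.tsum_coe]
  refine tsum_congr fun a => ?_
  by_cases ha : a ∈ s <;> simp [ha]

theorem ofReal_le_toOuterMeasure_uniformOfFinset {s : Finset α} (hs : s.Nonempty) {Q : α → Prop}
    [DecidablePred Q] {ρ : ℝ} (hρ : 0 ≤ ρ) (h : ρ * s.card ≤ ((s.filter Q).card : ℝ)) :
    ENNReal.ofReal ρ ≤ (PMF.uniformOfFinset s hs).toOuterMeasure {a | Q a} := by
  rw [PMF.toOuterMeasure_uniformOfFinset_apply]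
  have h2 : (s.card : ℝ≥0∞) ≠ 0 := by exact_mod_cast hs.card_pos.ne'
  rw [ENNReal.le_div_iff_mul_le (Or.inl h2) (Or.inl (ENNReal.natCast_ne_top _)),
    ← ENNReal.ofReal_natCast, ← ENNReal.ofReal_natCast, ← ENNReal.ofReal_mul hρ]
  refine (ENNReal.ofReal_le_ofReal h).trans (le_of_eq ?_)
  congr!

end Expectation

/-! ### The stopping rule: termination and probability of failure -/

section Search

open scoped ENNReal

variable {V : Type u} [Fintype V] [Nonempty V] (G : SimpleGraph V) (w : Sym2 V → ℝ)
  (P : Preclustering V) (p : Params) (batch : Clustering V → V → V → Fin p.η)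
  (Inv : Clustering V → Prop) (μ : Clustering V → ℕ)

/-- `Inv` is preserved by the rounds of the search, and `μ` decreases when the clustering changes. -/
def IsRank : Prop :=
  ∀ 𝒞, Inv 𝒞 → ∀ 𝒞' ∈ (round G w P p batch 𝒞).support, Inv 𝒞' ∧ (𝒞' ≠ 𝒞 → μ 𝒞' < μ 𝒞)

variable {G w P p batch Inv μ}

theorem mem_support_step {σ σ' : Clustering V × ℕ} (h : σ' ∈ (step G w P p batch σ).support) :
    (p.R ≤ σ.2 ∧ σ' = σ) ∨ (σ.2 < p.R ∧ ∃ 𝒞' ∈ (round G w P p batch σ.1).support,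
      σ' = if 𝒞' = σ.1 then (𝒞', σ.2 + 1) else (𝒞', 0)) := by
  unfold step at h
  split_ifs at h with hR
  · rw [PMF.mem_support_pure_iff] at h
    exact Or.inl ⟨hR, h⟩
  · rw [PMF.mem_support_map_iff] at h
    obtain ⟨𝒞', h1, h2⟩ := h
    exact Or.inr ⟨not_le.1 hR, 𝒞', h1, h2.symm⟩

/-- Before halting, `t + μ(R+1) + (R-k)` never increases. A round without change lowers `R-k` by
one; a change lowers `μ` by at least one, and the freed `R+1` pays for both the round and the reset
of the counter. -/
theorem law_support (hrank : IsRank G w P p batch Inv μ) (hinit : Inv P.initial) (t : ℕ) :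
    ∀ σ ∈ (law G w P p batch t).support, Inv σ.1 ∧
      (p.R ≤ σ.2 ∨ t + (μ σ.1 * (p.R + 1) + (p.R - σ.2)) ≤ μ P.initial * (p.R + 1) + p.R) := by
  induction t with
  | zero =>
    intro σ hσ
    rw [law, PMF.mem_support_pure_iff] at hσ
    subst hσ
    exact ⟨hinit, Or.inr (by simp)⟩
  | succ t ih =>
    intro σ' hσ'
    rw [law, PMF.mem_support_bind_iff] at hσ'
    obtain ⟨σ, hσ, hstep⟩ := hσ'
    obtain ⟨hI, hor⟩ := ih σ hσ
    rcases mem_support_step hstep with ⟨hR, rfl⟩ | ⟨hR, 𝒞', h𝒞', rfl⟩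
    · exact ⟨hI, Or.inl hR⟩
    · obtain ⟨hI', hdec⟩ := hrank σ.1 hI 𝒞' h𝒞'
      have hle := hor.resolve_left (not_le.2 hR)
      split_ifs with heq
      · refine ⟨hI', Or.inr ?_⟩
        simp only
        rw [heq]
        omega
      · refine ⟨hI', Or.inr ?_⟩
        have h1 : (μ 𝒞' + 1) * (p.R + 1) ≤ μ σ.1 * (p.R + 1) :=
          Nat.mul_le_mul_right _ (hdec heq)
        simp only
        rw [add_mul] at h1
        omega

theorem halts (hrank : IsRank G w P p batch Inv μ) (hinit : Inv P.initial) :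
    ∀ σ ∈ (law G w P p batch (μ P.initial * (p.R + 1) + p.R + 1)).support, p.R ≤ σ.2 := by
  intro σ hσ
  rcases (law_support hrank hinit _ σ hσ).2 with h | h
  · exact h
  · omega

variable (p μ) in
/-- Upper bound for the probability that the search stops in a bad clustering. -/
def failurePotential (Bad : Clustering V → Prop) (x : ℝ≥0∞) (σ : Clustering V × ℕ) : ℝ≥0∞ :=
  (if Bad σ.1 then x ^ (p.R - σ.2) else 0) + μ σ.1 * x ^ p.R

/-- The potential is a supermartingale. Staying in a bad clustering divides the first term by `x`,
but has probability at most `x`. A change creates a first term of at most `x^R`, which the drop of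
`μ` pays for. -/
theorem expect_step_le {Bad : Clustering V → Prop} {x : ℝ≥0∞} (hrank : IsRank G w P p batch Inv μ)
    (hbad : ∀ 𝒞, Inv 𝒞 → Bad 𝒞 → round G w P p batch 𝒞 𝒞 ≤ x) {σ : Clustering V × ℕ}
    (hσ : Inv σ.1) : expect (step G w P p batch σ) (failurePotential p μ Bad x) ≤
      failurePotential p μ Bad x σ := by
  obtain ⟨𝒞, k⟩ := σ
  unfold step
  split_ifs with hR
  · rw [expect_pure]
  · rw [expect_map]
    simp only at hR hσ ⊢
    have hle : ∀ 𝒞' ∈ (round G w P p batch 𝒞).support,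
        (failurePotential p μ Bad x ∘ fun 𝒞' => if 𝒞' = 𝒞 then (𝒞', k + 1) else (𝒞', 0)) 𝒞' ≤
        μ 𝒞 * x ^ p.R + if 𝒞' = 𝒞 then (if Bad 𝒞 then x ^ (p.R - (k + 1)) else 0) else 0 := by
      intro 𝒞' h𝒞'
      simp only [Function.comp_apply]
      by_cases heq : 𝒞' = 𝒞
      · simp only [heq, if_true, failurePotential]
        rw [add_comm]
      · simp only [heq, if_false, failurePotential, add_zero, Nat.sub_zero]
        have h1 := (hrank 𝒞 hσ 𝒞' h𝒞').2 heq
        have h2 : ((μ 𝒞' + 1 : ℕ) : ℝ≥0∞) ≤ μ 𝒞 := by exact_mod_cast h1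
        calc (if Bad 𝒞' then x ^ p.R else 0) + μ 𝒞' * x ^ p.R
            ≤ x ^ p.R + μ 𝒞' * x ^ p.R := by
              gcongr
              split_ifs
              · exact le_rfl
              · exact zero_le
          _ = ((μ 𝒞' + 1 : ℕ) : ℝ≥0∞) * x ^ p.R := by
              push_cast
              ring
          _ ≤ _ := by gcongr
    refine (expect_mono_support hle).trans ?_
    rw [expect_const_add_indicator]
    unfold failurePotential
    rw [add_comm]
    gcongr
    simp only
    split_ifs with hB
    · calc round G w P p batch 𝒞 𝒞 * x ^ (p.R - (k + 1)) ≤ x * x ^ (p.R - (k + 1)) := by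
            gcongr
            exact hbad 𝒞 hσ hB
        _ = x ^ (p.R - k) := by
            rw [← pow_succ']
            congr 1
            omega
    · simp

theorem expect_law_le {Bad : Clustering V → Prop} {x : ℝ≥0∞} (hrank : IsRank G w P p batch Inv μ)
    (hbad : ∀ 𝒞, Inv 𝒞 → Bad 𝒞 → round G w P p batch 𝒞 𝒞 ≤ x) (hinit : Inv P.initial) (t : ℕ) :
    expect (law G w P p batch t) (failurePotential p μ Bad x) ≤ (1 + μ P.initial) * x ^ p.R := by
  induction t with
  | zero =>
    rw [law, expect_pure, failurePotential, add_mul, one_mul]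
    gcongr
    split_ifs
    · exact le_rfl
    · exact zero_le
  | succ t ih =>
    rw [law, expect_bind]
    refine le_trans (expect_mono_support fun σ hσ => ?_) ih
    exact expect_step_le hrank hbad (law_support hrank hinit t σ hσ).1

/-- If a bad clustering survives a round with probability at most `x`, then the search ends in a good
clustering up to an error proportional to `x ^ R`. -/
theorem le_toOuterMeasure_not_bad {Bad : Clustering V → Prop} {x : ℝ≥0∞}
    (hrank : IsRank G w P p batch Inv μ)
    (hbad : ∀ 𝒞, Inv 𝒞 → Bad 𝒞 → round G w P p batch 𝒞 𝒞 ≤ x) (hinit : Inv P.initial) {t : ℕ}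
    (ht : ∀ σ ∈ (law G w P p batch t).support, p.R ≤ σ.2) :
    1 - (1 + μ P.initial) * x ^ p.R ≤
      (law G w P p batch t).toOuterMeasure {σ | ¬ Bad σ.1} := by
  rw [tsub_le_iff_right]
  refine (toOuterMeasure_add_compl (law G w P p batch t) {σ | ¬ Bad σ.1}).symm.le.trans ?_
  gcongr
  refine le_trans (toOuterMeasure_le_expect fun σ hσ hB => ?_)
    (expect_law_le hrank hbad hinit t)
  have hB' : Bad σ.1 := by simpa using hB
  -- After halting, the truncated difference `R - k` is `0`, so the potential of a bad state is at
  -- least `x^0 = 1`.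
  rw [failurePotential, if_pos hB', Nat.sub_eq_zero_of_le (ht σ hσ), pow_zero]
  exact le_self_add

theorem mem_support_round {𝒞 𝒞' : Clustering V} (h : 𝒞' ∈ (round G w P p batch 𝒞).support) :
    ∃ r', 𝒞' = singletonStep G w 𝒞 r' ∨
      ∃ r T, 𝒞' = pivotStep G w P p batch (singletonStep G w 𝒞 r') r T := by
  unfold round at h
  rw [PMF.mem_support_bind_iff] at h
  obtain ⟨r', -, h⟩ := h
  rw [PMF.mem_support_bind_iff] at h
  obtain ⟨o, -, h⟩ := h
  refine ⟨r', ?_⟩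
  cases o with
  | none =>
    rw [PMF.mem_support_pure_iff] at h
    exact Or.inl h
  | some r =>
    rw [PMF.mem_support_map_iff] at h
    obtain ⟨T, -, h⟩ := h
    exact Or.inr ⟨r, T, h.symm⟩

theorem apply_le_one_sub {α : Type*} {q : PMF α} {a : α} {c : ℝ≥0∞}
    (h : c ≤ q.toOuterMeasure {b | b ≠ a}) : q a ≤ 1 - c := by
  have h1 := toOuterMeasure_add_compl q {b | b ≠ a}
  have h2 : ({b | b ≠ a} : Set α)ᶜ = {a} := by
    ext
    simp
  rw [h2, PMF.toOuterMeasure_apply_singleton] at h1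
  refine ENNReal.le_sub_of_add_le_left ?_ ?_
  · refine ne_top_of_le_ne_top ENNReal.one_ne_top (h.trans ?_)
    rw [← h1]
    exact le_self_add
  · rw [← h1]
    gcongr

/-- The vertex `v` is drawn with probability `1/n`. The pivot step of the same round cannot undo the
change, since it never raises the cost. -/
theorem round_apply_self_le_of_singleton (hγ : 0 ≤ p.γ) {𝒞 : Clustering V} {v : V}
    (hv : cost G w (addCluster 𝒞 {v}) < cost G w 𝒞) :
    round G w P p batch 𝒞 𝒞 ≤ 1 - (Fintype.card V : ℝ≥0∞)⁻¹ := by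
  refine apply_le_one_sub ?_
  unfold round
  rw [PMF.toOuterMeasure_bind_apply]
  refine le_trans ?_ (ENNReal.le_tsum v)
  rw [PMF.uniformOfFintype_apply]
  refine le_mul_of_one_le_right' (le_of_eq ?_)
  symm
  rw [PMF.toOuterMeasure_apply_eq_one_iff]
  have hs : singletonStep G w 𝒞 v = addCluster 𝒞 {v} := by
    unfold singletonStep
    rw [if_pos hv]
  have hδ : 0 ≤ p.γ * P.numAdm / Fintype.card V := by positivity
  intro 𝒞' h
  rw [PMF.mem_support_bind_iff] at h
  obtain ⟨o, -, h⟩ := h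
  change 𝒞' ≠ 𝒞
  cases o with
  | none =>
    rw [PMF.mem_support_pure_iff, hs] at h
    intro heq
    rw [← h, heq] at hv
    exact lt_irrefl _ hv
  | some r =>
    rw [PMF.mem_support_map_iff] at h
    obtain ⟨T, -, h⟩ := h
    rw [hs] at h
    intro heq
    have hlt : cost G w (pivotStep G w P p batch (addCluster 𝒞 {v}) r T) < cost G w 𝒞 := by
      rcases pivotStep_eq_or_cost_le (G := G) (w := w) (P := P) p batch (addCluster 𝒞 {v}) r T
        with h1 | h1
      · rwa [h1]
      · linarith
    rw [h, heq] at hlt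
    exact lt_irrefl _ hlt

/-- When no singleton step changes `𝒞`, the pivot step acts on `𝒞` itself, and the events of
choosing different pivots in `Q` are disjoint, so their probabilities add. -/
theorem round_apply_self_le_of_pivots {𝒞 : Clustering V}
    (hs : ∀ v, singletonStep G w 𝒞 v = 𝒞) (Q : Finset V) {c ρ : ℝ} (hρ : 0 ≤ ρ)
    (hQ : c / Fintype.card V ≤ ∑ r ∈ Q, 1 / ((Fintype.card V : ℝ) * G.degree r))
    (hsucc : ∀ r ∈ Q, ρ * (Fintype.piFinset fun _ : Fin p.η =>
        (P.N r).powersetCard (min p.s (P.N r).card)).card ≤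
      (((Fintype.piFinset fun _ : Fin p.η =>
        (P.N r).powersetCard (min p.s (P.N r).card)).filter (fun T =>
          pivotStep G w P p batch 𝒞 r T ≠ 𝒞)).card : ℝ)) :
    round G w P p batch 𝒞 𝒞 ≤ 1 - ENNReal.ofReal (c * ρ / Fintype.card V) := by
  refine apply_le_one_sub ?_
  unfold round
  simp_rw [hs]
  rw [PMF.bind_const, PMF.toOuterMeasure_bind_apply]
  refine le_trans ?_ (ENNReal.sum_le_tsum (Q.map Function.Embedding.some))
  rw [Finset.sum_map]
  have hterm : ∀ r ∈ Q, ENNReal.ofReal (1 / ((Fintype.card V : ℝ) * G.degree r) * ρ) ≤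
      pivotLaw G (some r) * ((subsetLaw P p r).map fun T =>
          pivotStep G w P p batch 𝒞 r T).toOuterMeasure {𝒟 | 𝒟 ≠ 𝒞} := by
    intro r hr
    have h1 : pivotLaw G (some r) = ENNReal.ofReal (1 / ((Fintype.card V : ℝ) * G.degree r)) := rfl
    rw [h1, ENNReal.ofReal_mul (by positivity)]
    gcongr
    rw [PMF.toOuterMeasure_map_apply, subsetLaw]
    exact ofReal_le_toOuterMeasure_uniformOfFinset _ hρ (hsucc r hr)
  refine le_trans ?_ (Finset.sum_le_sum hterm)
  rw [← ENNReal.ofReal_sum_of_nonneg (fun _ _ => by positivity), ← Finset.sum_mul]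
  refine ENNReal.ofReal_le_ofReal ?_
  calc c * ρ / Fintype.card V = c / Fintype.card V * ρ := by ring
    _ ≤ _ := by gcongr

end Search

/-! ### The rank, and the progress made in one round -/

section Rank

variable {V : Type u} [Fintype V] {G : SimpleGraph V} {w : Sym2 V → ℝ}
  {P : Preclustering V} {p : Params} {batch : Clustering V → V → V → Fin p.η}

/-- The number of vertices that are not singleton clusters. -/
def nonSingletons (𝒞 : Clustering V) : ℕ :=
  (Finset.univ.filter (fun v => {v} ∉ 𝒞.parts)).card

variable (G w P p) in
/-- A rank which decreases whenever a round changes the clustering. -/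
def costRank (𝒞 : Clustering V) : ℕ :=
  (Fintype.card V + 1) * ⌊cost G w 𝒞 / (p.γ * P.numAdm / Fintype.card V)⌋₊ + nonSingletons 𝒞

theorem nonSingletons_le (𝒞 : Clustering V) : nonSingletons 𝒞 ≤ Fintype.card V :=
  Finset.card_filter_le _ _

theorem nonSingletons_addCluster_lt {𝒞 : Clustering V} {v : V} (hv : {v} ∉ 𝒞.parts) :
    nonSingletons (addCluster 𝒞 {v}) < nonSingletons 𝒞 := by
  refine Finset.card_lt_card (Finset.ssubset_iff_of_subset ?_ |>.2 ⟨v, ?_, ?_⟩)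
  · intro u hu
    rw [Finset.mem_filter] at hu ⊢
    refine ⟨hu.1, fun hu' => hu.2 (mem_parts_addCluster.2 ?_)⟩
    have huv : u ≠ v := by
      rintro rfl
      exact hv hu'
    refine Or.inr ⟨{u}, hu', by simpa using huv, ?_⟩
    exact Finset.sdiff_eq_self_of_disjoint (Finset.disjoint_singleton.2 huv)
  · simpa using hv
  · simp only [Finset.mem_filter, Finset.mem_univ, true_and, not_not]
    exact mem_parts_addCluster.2 (Or.inl ⟨rfl, Finset.singleton_nonempty v⟩)

variable [Nonempty V]

/-- A pivot step saves at least one unit `γ|E_adm|/n`, and the weight `n + 1` on the floor exceeds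
any increase of the number of nonsingletons. A singleton step may save arbitrarily little because
weights are real, but it creates a new singleton cluster and destroys none. -/
theorem isRank_costRank {W : ℝ} (hw : IsWeight G w W) (hγ : 0 < p.γ) (hP : 0 < P.numAdm) :
    IsRank G w P p batch (fun _ => True) (costRank G w P p) := by
  intro 𝒞 _ 𝒞' h𝒞'
  refine ⟨trivial, fun hne => ?_⟩
  have hn : (0 : ℝ) < Fintype.card V := by exact_mod_cast Fintype.card_pos
  have hP' : (0 : ℝ) < P.numAdm := by exact_mod_cast hP
  set δ := p.γ * P.numAdm / Fintype.card V with hδ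
  have hδ0 : 0 < δ := by positivity
  have hsing : ∀ v, singletonStep G w 𝒞 v ≠ 𝒞 →
      costRank G w P p (singletonStep G w 𝒞 v) < costRank G w P p 𝒞 := by
    intro v hv
    unfold singletonStep at hv ⊢
    split_ifs at hv ⊢ with h
    · have hnot : {v} ∉ 𝒞.parts := fun hmem => hv (addCluster_of_mem_parts hmem)
      have h1 : ⌊cost G w (addCluster 𝒞 {v}) / δ⌋₊ ≤ ⌊cost G w 𝒞 / δ⌋₊ := by gcongr
      exact add_lt_add_of_le_of_lt (Nat.mul_le_mul_left _ h1) (nonSingletons_addCluster_lt hnot)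
    · exact absurd rfl hv
  have hpiv : ∀ 𝒟 r T, pivotStep G w P p batch 𝒟 r T ≠ 𝒟 →
      costRank G w P p (pivotStep G w P p batch 𝒟 r T) < costRank G w P p 𝒟 := by
    intro 𝒟 r T hne
    have h1 := (pivotStep_eq_or_cost_le p batch 𝒟 r T).resolve_left hne
    set 𝒟' := pivotStep G w P p batch 𝒟 r T
    change cost G w 𝒟' ≤ cost G w 𝒟 - δ at h1
    have h2 : cost G w 𝒟' / δ + 1 ≤ cost G w 𝒟 / δ := by
      rw [← div_self hδ0.ne', ← add_div]
      gcongr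
      linarith
    have h3 : ⌊cost G w 𝒟' / δ⌋₊ + 1 ≤ ⌊cost G w 𝒟 / δ⌋₊ := by
      rw [← Nat.floor_add_one (div_nonneg (cost_nonneg hw _) hδ0.le)]
      exact Nat.floor_le_floor h2
    have h4 := nonSingletons_le 𝒟'
    have h5 := Nat.mul_le_mul_left (Fintype.card V + 1) h3
    unfold costRank
    rw [← hδ]
    rw [mul_add] at h5
    omega
  obtain ⟨v, h | ⟨r, T, h⟩⟩ := mem_support_round h𝒞'
  · rw [h] at hne ⊢
    exact hsing v hne
  · rw [h] at hne ⊢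
    by_cases h1 : pivotStep G w P p batch (singletonStep G w 𝒞 v) r T = singletonStep G w 𝒞 v
    · rw [h1] at hne ⊢
      exact hsing v hne
    · have h2 := hpiv _ r T h1
      by_cases h3 : singletonStep G w 𝒞 v = 𝒞
      · rw [h3] at h2 ⊢
        exact h2
      · exact h2.trans (hsing v h3)

/-- One admissible pair already makes the unit at least `γ/n`, and the cost is at most `Wn²`. -/
theorem costRank_le {W : ℝ} (hw : IsWeight G w W) (hW : 1 ≤ W) (hγ : 0 < p.γ) (hP : 0 < P.numAdm)
    (𝒞 : Clustering V) : (costRank G w P p 𝒞 : ℝ) ≤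
      (Fintype.card V + 1) * (W * (Fintype.card V : ℝ) ^ 3 / p.γ) + Fintype.card V := by
  have hn : (0 : ℝ) < Fintype.card V := by exact_mod_cast Fintype.card_pos
  have hP' : (1 : ℝ) ≤ P.numAdm := by exact_mod_cast hP
  unfold costRank
  push_cast
  gcongr
  · refine (Nat.floor_le (div_nonneg (cost_nonneg hw _) (by positivity))).trans ?_
    rw [div_le_div_iff₀ (by positivity) hγ]
    have h1 := cost_le hw hW 𝒞
    calc cost G w 𝒞 * p.γ ≤ W * (Fintype.card V : ℝ) ^ 2 * p.γ * 1 := by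
          rw [mul_one]
          gcongr
      _ ≤ W * (Fintype.card V : ℝ) ^ 2 * p.γ * P.numAdm := by gcongr
      _ = _ := by field_simp
  · exact nonSingletons_le 𝒞

/-- A clustering which is not locally optimal changes in a round with probability `Ω(1 / n)`. -/
theorem round_apply_self_le {A : ℝ} (hw : IsWeight G w p.W) (hW : 1 ≤ p.W) (hε : 0 < p.ε)
    (hε1 : p.ε ≤ 1) (hA : A * p.ε ≤ 1 / 4) (hγ : 0 < p.γ) (hgood : P.IsGood G A p.ε)
    (hη : 2 ≤ p.η) (hηγ : 1300 * p.W * p.ε⁻¹ ^ 8 / p.γ ≤ p.η) (hbatch : IsBatching P batch)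
    (hs : 2 * p.η ^ 5 ≤ p.s) (hκ : (p.η : ℝ) ≤ (1 + 1 / (p.η : ℝ) ^ 2) ^ p.κ)
    (hκ' : 40 * p.ε⁻¹ ^ 4 ≤ (1 + 1 / (p.η : ℝ) ^ 2) ^ p.κ) (hP : 0 < P.numAdm)
    {Opt : Clustering V} (hOpt : P.IsGoodClustering G p.ε Opt) {𝒞 : Clustering V}
    (h𝒞 : ¬ P.IsGoodLocalOpt G w (3 / 2 * p.γ) (P.split p.ε Opt) 𝒞) :
    round G w P p batch 𝒞 𝒞 ≤
      1 - ENNReal.ofReal (min 1 (p.ε / 2 * sampleRate p.η) / Fintype.card V) := by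
  have hn : (0 : ℝ) < Fintype.card V := by exact_mod_cast Fintype.card_pos
  have hP' : (0 : ℝ) < P.numAdm := by exact_mod_cast hP
  have hη' : (2 : ℝ) ≤ p.η := by exact_mod_cast hη
  have hδ0 : 0 < p.γ * P.numAdm / Fintype.card V := by positivity
  by_cases hsing : ∃ v, cost G w (addCluster 𝒞 {v}) < cost G w 𝒞
  · obtain ⟨v, hv⟩ := hsing
    refine (round_apply_self_le_of_singleton hγ.le hv).trans ?_
    refine tsub_le_tsub_left ?_ 1
    calc ENNReal.ofReal (min 1 (p.ε / 2 * sampleRate p.η) / Fintype.card V)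
        ≤ ENNReal.ofReal ((Fintype.card V : ℝ)⁻¹) := by
          refine ENNReal.ofReal_le_ofReal ?_
          rw [← one_div]
          gcongr
          exact min_le_left _ _
      _ = (Fintype.card V : ENNReal)⁻¹ := by
          rw [ENNReal.ofReal_inv_of_pos hn, ENNReal.ofReal_natCast]
  · push Not at hsing
    have hstep : ∀ v, singletonStep G w 𝒞 v = 𝒞 := by
      intro v
      unfold singletonStep
      rw [if_neg (not_lt.2 (hsing v))]
    obtain ⟨C, hC, hCcost⟩ := exists_improving_cluster hγ _ _ h𝒞
    have hCne := (P.split p.ε Opt).nonempty_of_mem_parts hC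
    -- The cluster found is not a singleton, since adding it strictly lowers the cost and no
    -- singleton does.
    have hadm0 : 0 ≤ p.γ * P.admDeg C := by positivity
    have hC1 : 1 < C.card := by
      by_contra hle
      have h1 : C.card = 1 := by
        have := hCne.card_pos
        omega
      obtain ⟨v, rfl⟩ := Finset.card_eq_one.1 h1
      have := hsing v
      linarith
    obtain ⟨Q, -, hQne, hQ⟩ := (P.isTarget_of_mem_split hε hε1 hOpt hC).exists_pivots hε hε1 hA hgood hC1
    have hrate := (sampleRate_pos (show 0 < p.η by omega)).le
    refine (round_apply_self_le_of_pivots (c := p.ε / 2) hstep Q hrate ?_ ?_).trans ?_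
    · have hQc : (0 : ℝ) < Q.card := by exact_mod_cast hQne.card_pos
      calc p.ε / 2 / Fintype.card V = ∑ r ∈ Q, p.ε / 2 / (Fintype.card V * Q.card) := by
            rw [Finset.sum_const, nsmul_eq_mul]
            field_simp
        _ ≤ _ := by
            refine Finset.sum_le_sum fun r hr => ?_
            obtain ⟨-, -, hd, hdQ, -⟩ := hQ r hr
            have hd' : (0 : ℝ) < G.degree r := by exact_mod_cast hd
            rw [div_le_div_iff₀ (by positivity) (by positivity)]
            calc p.ε / 2 * (Fintype.card V * G.degree r)
                = Fintype.card V * (p.ε / 2 * G.degree r) := by ring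
              _ ≤ Fintype.card V * Q.card := by gcongr
              _ = _ := by ring
    · intro r hr
      obtain ⟨hKC, hCN, hd, -, hDN, hlo, hhi⟩ := hQ r hr
      have hd' : (0 : ℝ) < G.degree r := by exact_mod_cast hd
      set b := 1 + 1 / (p.η : ℝ) ^ 2 with hb
      have hbpos : 0 < b := by positivity
      refine (sampleRate_mul_card_le hw hW hη hbatch hs 𝒞 hKC hCN (by positivity) ?_ ?_).trans ?_
      · refine hhi.trans ?_
        calc 20 * p.ε⁻¹ ^ 3 * (G.degree r : ℝ)
            = p.ε * G.degree r / 2 * (40 * p.ε⁻¹ ^ 4) := by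
              field_simp
              ring
          _ ≤ _ := by gcongr
      · rw [zpow_neg, zpow_natCast]
        calc p.ε * G.degree r / 2 * (b ^ p.κ)⁻¹ ≤ (P.N r).card * (p.η : ℝ)⁻¹ := by
              gcongr
              linarith
          _ = _ := by rw [div_eq_mul_inv]
      · refine Nat.cast_le.2 (Finset.card_le_card fun T hT => ?_)
        rw [Finset.mem_filter] at hT ⊢
        refine ⟨hT.1, fun heq => ?_⟩
        obtain ⟨x, hx, hcost⟩ := hT.2
        -- Here `1300 = 13 · 100`: loss per vertex times the bound on `|D(r)||N(r)|`. The term `γ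
        -- d^adm(C)` in the saving of `C` absorbs this loss, leaving the acceptance threshold
        -- `γ|E_adm|/n`.
        have hloss : ((P.D r).card : ℝ) * (13 * p.W * (P.N r).card / p.η) ≤ p.γ * P.admDeg C := by
          rw [div_le_iff₀ hγ] at hηγ
          calc ((P.D r).card : ℝ) * (13 * p.W * (P.N r).card / p.η)
              = 13 * p.W * ((P.D r).card * (P.N r).card) / p.η := by ring
            _ ≤ 13 * p.W * (100 * p.ε⁻¹ ^ 8 * P.admDeg C) / p.η := by gcongr
            _ = 1300 * p.W * p.ε⁻¹ ^ 8 * P.admDeg C / p.η := by ring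
            _ ≤ p.η * p.γ * P.admDeg C / p.η := by gcongr
            _ = _ := by field_simp
        have hlt := cost_pivotStep_lt (G := G) (w := w) p batch (𝒞 := 𝒞) (r := r) (T := T) hδ0
          ⟨x, hx, by linarith⟩
        rw [heq] at hlt
        exact lt_irrefl _ hlt
    · refine tsub_le_tsub_left (ENNReal.ofReal_le_ofReal ?_) 1
      gcongr
      exact min_le_right _ _

end Rank

/-! ### The degenerate case without admissible pairs -/

section NoAdmissiblePairs

variable {V : Type u} [Fintype V] {G : SimpleGraph V} {w : Sym2 V → ℝ} {P : Preclustering V}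

theorem Preclustering.not_adj_of_numAdm_eq_zero (hP : P.numAdm = 0) (u v : V) :
    ¬ P.adm.Adj u v := by
  intro h
  have h1 : s(u, v) ∈ P.adm.edgeFinset := by simpa using h
  rw [Preclustering.numAdm, Finset.card_eq_zero] at hP
  rw [hP] at h1
  simp at h1

theorem addCluster_empty (𝒞 : Clustering V) : addCluster 𝒞 ∅ = 𝒞 := by
  refine clustering_ext fun v u => ?_
  rw [mem_part_addCluster]
  simp

/-- The vertex has at least `3|K|/4 - 1` neighbours in its atom, so its affinity to the other
members is at least `2(3|K|/4 - 1) - |K| + 1 = |K|/2 - 1`, which is nonnegative for `|K| ≥ 2`. -/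
theorem cost_initial_le_addCluster_singleton {A ε W : ℝ} (hw : IsWeight G w W) (hW : 1 ≤ W)
    (hA : A * ε ≤ 1 / 4) (hgood : P.IsGood G A ε) {v : V} {K : Finset V} (hK : K ∈ P.atoms)
    (hv : v ∈ K) (hcard : 1 < K.card) :
    cost G w P.initial ≤ cost G w (addCluster P.initial {v}) := by
  have h1 := cost_addCluster_le hw hW P.initial (B := {v}) (X := {v}) (X' := ∅) (by simp)
  rw [addCluster_empty] at h1
  have hpart : P.initial.part v = K :=
    P.initial.part_eq_of_mem (Preclustering.mem_initial_parts.2 (Or.inl hK)) hv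
  have hin := (hgood.2.2 K hK v hv).1
  have hKR : (2 : ℝ) ≤ K.card := by exact_mod_cast hcard
  have hAK : A * ε * K.card ≤ 1 / 4 * K.card := by gcongr
  have hwd : degIn G v K ≤ wdegIn G w v K := by
    unfold degIn wdegIn
    rw [Finset.card_eq_sum_ones]
    push_cast
    exact Finset.sum_le_sum fun u hu => hw.one_le (Finset.mem_filter.1 hu).2
  have hsum := sum_affinity G w v K
  have hsplit := Finset.sum_sdiff (f := affinity G w v) (Finset.singleton_subset_iff.2 hv)
  rw [Finset.sum_singleton, affinity_self] at hsplit
  have hgain : moveGain G w P.initial {v} {v} v ≤ 0 := by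
    unfold moveGain
    rw [hpart, Finset.sdiff_self, Finset.sum_empty]
    linarith
  simp only [Finset.sum_singleton, Finset.mem_singleton, if_true, Finset.notMem_empty, if_false,
    Finset.card_singleton] at h1
  norm_num at h1
  linarith

/-- All sets `D(r)` are empty, so every candidate is `K(r)`, already a cluster. The initial
clustering is thus a fixed point, for which the zero rank suffices. -/
theorem isRank_of_numAdm_eq_zero [Nonempty V] {p : Params}
    {batch : Clustering V → V → V → Fin p.η} {A ε W : ℝ} (hw : IsWeight G w W) (hW : 1 ≤ W)
    (hA : A * ε ≤ 1 / 4) (hgood : P.IsGood G A ε) (hP : P.numAdm = 0) :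
    IsRank G w P p batch (fun 𝒞 => 𝒞 = P.initial) (fun _ => 0) := by
  have hadj := P.not_adj_of_numAdm_eq_zero hP
  have hK : ∀ r, P.K r ∈ P.initial.parts := by
    intro r
    rw [Preclustering.mem_initial_parts]
    by_cases hr : P.InAtom r
    · obtain ⟨K, hK, hrK⟩ := hr
      rw [P.K_eq_of_mem hK hrK]
      exact Or.inl hK
    · exact Or.inr ⟨r, hr, (P.K_eq_singleton hr).symm⟩
  have hD : ∀ r, P.D r = ∅ := by
    intro r
    refine Finset.eq_empty_of_forall_notMem fun x hx => ?_
    exact hadj r x (P.adj_of_mem_D hx r (P.self_mem_K r))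
  have hs : ∀ v, singletonStep G w P.initial v = P.initial := by
    intro v
    unfold singletonStep
    split_ifs with hlt
    · refine addCluster_of_mem_parts ?_
      have hv := hK v
      by_cases hvA : P.InAtom v
      · obtain ⟨K, hKA, hvK⟩ := hvA
        rw [P.K_eq_of_mem hKA hvK] at hv
        by_cases hcard : 1 < K.card
        · exact absurd hlt
            (not_lt.2 (cost_initial_le_addCluster_singleton hw hW hA hgood hKA hvK hcard))
        · have : K = {v} := Finset.eq_singleton_iff_unique_mem.2
            ⟨hvK, fun u hu => Finset.card_le_one.1 (not_lt.1 hcard) u hu v hvK⟩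
          rwa [this] at hv
      · rwa [P.K_eq_singleton hvA] at hv
    · rfl
  have htry : ∀ r x, tryCandidate G w P p batch P.initial r x = P.initial := by
    intro r x
    unfold tryCandidate generateCluster
    rw [hD, Finset.filter_empty, Finset.union_empty]
    exact addCluster_of_mem_parts (hK r)
  have hp : ∀ r T, pivotStep G w P p batch P.initial r T = P.initial := by
    intro r T
    unfold pivotStep
    split_ifs
    · simp only [htry]
      split_ifs <;> rfl
    · rfl
  rintro 𝒞 rfl 𝒞' h𝒞'
  have : 𝒞' = P.initial := by
    obtain ⟨v, h | ⟨r, T, h⟩⟩ := mem_support_round h𝒞'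
    · rw [h, hs]
    · rw [h, hs, hp]
  exact ⟨this, fun h => absurd this h⟩

/-- Every cluster of the split optimum is an atom or a singleton outside the atoms, hence a cluster
of the initial clustering, and adding it changes nothing. -/
theorem isGoodLocalOpt_initial {ε γ : ℝ} (hε : 0 < ε) (hε1 : ε ≤ 1) (hP : P.numAdm = 0)
    {Opt : Clustering V} (hOpt : P.IsGoodClustering G ε Opt) :
    P.IsGoodLocalOpt G w γ (P.split ε Opt) P.initial := by
  unfold Preclustering.IsGoodLocalOpt
  rw [hP, Finset.sum_eq_zero]
  · simp
  · intro C hC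
    have hmem := (P.isTarget_of_mem_split hε hε1 hOpt hC).mem_initial_parts
      (P.not_adj_of_numAdm_eq_zero hP) ((P.split ε Opt).nonempty_of_mem_parts hC)
    rw [addCluster_of_mem_parts hmem, sub_self]

end NoAdmissiblePairs

/-! ### Estimates for the failure bound -/

section Numerics

theorem one_sub_div_pow_le {n R k : ℕ} {c : ℝ} (hn : 0 < n) (hc : 0 < c) (hcn : c ≤ n)
    (hR : k / c * n * Real.log n ≤ R) : (1 - c / n) ^ R ≤ ((n : ℝ) ^ k)⁻¹ := by
  have hn' : (0 : ℝ) < n := by exact_mod_cast hn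
  have h1 : 1 - c / n ≤ Real.exp (-(c / n)) := by
    have := Real.add_one_le_exp (-(c / n))
    linarith
  have h0 : 0 ≤ 1 - c / n := by
    rw [sub_nonneg, div_le_one hn']
    exact hcn
  calc (1 - c / n) ^ R ≤ Real.exp (-(c / n)) ^ R := by gcongr
    _ = Real.exp (-(c / n * R)) := by
        rw [← Real.exp_nat_mul]
        congr 1
        ring
    _ ≤ Real.exp (-(k * Real.log n)) := by
        rw [Real.exp_le_exp, neg_le_neg_iff]
        calc k * Real.log n = c / n * (k / c * n * Real.log n) := by field_simp
          _ ≤ _ := by gcongr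
    _ = _ := by
        rw [Real.exp_neg, Real.exp_nat_mul, Real.exp_log hn']

/-- For `n ≥ 2` the constant `1 + 2W/γ` is absorbed into a power of `n`, so that the factor in front
of `x^R` becomes a pure power. -/
theorem rank_bound_le {n M : ℕ} {W γ : ℝ} (hn : 2 ≤ n) (hW : 1 ≤ W) (hγ : 0 < γ)
    (hM : 1 + 2 * W / γ ≤ 2 ^ M) :
    1 + ((n + 1) * (W * (n : ℝ) ^ 3 / γ) + n) ≤ (n : ℝ) ^ (4 + M) := by
  have hn' : (2 : ℝ) ≤ n := by exact_mod_cast hn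
  have hWγ : 0 < W / γ := by positivity
  calc 1 + ((n + 1) * (W * (n : ℝ) ^ 3 / γ) + n)
      = (1 + n) + (n + 1) * (n : ℝ) ^ 3 * (W / γ) := by ring
    _ ≤ (n : ℝ) ^ 4 + (2 * n) * (n : ℝ) ^ 3 * (W / γ) := by
        gcongr
        · nlinarith [sq_nonneg ((n : ℝ) ^ 2 - 1), sq_nonneg ((n : ℝ) - 1)]
        · linarith
    _ = (n : ℝ) ^ 4 * (1 + 2 * W / γ) := by ring
    _ ≤ (n : ℝ) ^ 4 * 2 ^ M := by gcongr
    _ ≤ (n : ℝ) ^ 4 * (n : ℝ) ^ M := by gcongr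
    _ = _ := by rw [pow_add]

end Numerics

end CorrClust

end

/-! ### Choice of the constants and conclusion -/

theorem mainTheorem5 (A : ℝ) :
    ∃ ε₀ : ℝ, 0 < ε₀ ∧ ∀ ε γ W : ℝ, 0 < ε → ε < ε₀ → 0 < γ → γ < ε ^ 13 / 4 → 1 ≤ W →
    ∃ η₀ : ℕ, ∀ η : ℕ, η₀ ≤ η →
    ∃ s₀ κ₀ : ℕ, ∀ s κ : ℕ, s₀ ≤ s → κ₀ ≤ κ →
    ∀ a : ℕ, ∃ c : ℝ, 0 < c ∧
    ∀ (V : Type*) [Fintype V] [Nonempty V] (G : SimpleGraph V) (w : Sym2 V → ℝ)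
      (P : CorrClust.Preclustering V) (batch : CorrClust.Clustering V → V → V → Fin η)
      (Opt : CorrClust.Clustering V) (R : ℕ),
      CorrClust.IsWeight G w W →
      P.IsGood G A ε →
      CorrClust.IsBatching P batch →
      P.IsGoodClustering G ε Opt →
      c * Fintype.card V * Real.log (Fintype.card V) ≤ R →
      ∃ t : ℕ,
        (∀ σ ∈ (CorrClust.law G w P ⟨ε, γ, W, η, s, κ, R⟩ batch t).support, R ≤ σ.2) ∧
        ENNReal.ofReal (1 - 1 / (Fintype.card V : ℝ) ^ a) ≤
          (CorrClust.law G w P ⟨ε, γ, W, η, s, κ, R⟩ batch t).toOuterMeasure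
            {σ | P.IsGoodLocalOpt G w (3 / 2 * γ) (P.split ε Opt) σ.1} := by
  -- This bound on `ε` gives `Aε ≤ 1/4`: each member of an atom sees at least three quarters of it
  -- and few vertices outside.
  refine ⟨min 1 (1 / (4 * (|A| + 1))), by positivity, ?_⟩
  intro ε γ W hε hε₀ hγ _ hW
  have hε1 : ε ≤ 1 := hε₀.le.trans (min_le_left _ _)
  have hA : A * ε ≤ 1 / 4 := by
    have h1 : ε ≤ 1 / (4 * (|A| + 1)) := hε₀.le.trans (min_le_right _ _)
    rw [le_div_iff₀ (by positivity)] at h1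
    have h2 : A * ε ≤ |A| * ε := by
      gcongr
      exact le_abs_self A
    linarith
  -- The size of `η` makes the loss `13W|D(r)||N(r)|/η` at most `γ d^adm(C)`.
  refine ⟨max 2 ⌈1300 * W * ε⁻¹ ^ 8 / γ⌉₊, fun η hη => ?_⟩
  have hη2 : 2 ≤ η := (le_max_left _ _).trans hη
  have hηγ : 1300 * W * ε⁻¹ ^ 8 / γ ≤ η := Nat.ceil_le.1 ((le_max_right _ _).trans hη)
  have hηR : (2 : ℝ) ≤ η := by exact_mod_cast hη2
  have hb : 1 < 1 + 1 / (η : ℝ) ^ 2 := by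
    have : 0 < 1 / (η : ℝ) ^ 2 := by positivity
    linarith
  -- The size guesses are centred at `ε d(r)/2`, which is at most `|N(r)|`. The factor `η` brings
  -- the smallest below `|N(r)|/η`, and `40ε^(-4)` brings the largest above `20ε^(-3) d(r) ≥
  -- |N(r)|`.
  obtain ⟨κ₀, hκ₀⟩ := pow_unbounded_of_one_lt (max (η : ℝ) (40 * ε⁻¹ ^ 4)) hb
  refine ⟨2 * η ^ 5, κ₀, fun s κ hs hκ a => ?_⟩
  have hpow := hκ₀.le.trans (pow_le_pow_right₀ hb.le hκ)
  obtain ⟨M, hM⟩ := pow_unbounded_of_one_lt (1 + 2 * W / γ) (one_lt_two : (1 : ℝ) < 2)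
  set q := min 1 (ε / 2 * CorrClust.sampleRate η) with hq
  have hq0 : 0 < q := by
    have := CorrClust.sampleRate_pos (show 0 < η by omega)
    exact lt_min one_pos (by positivity)
  -- With this `c`, `(1 - q/n)^R ≤ n^(-(a+4+M))`; the factor `n^(4+M)` pays for one plus the rank of
  -- the initial clustering.
  refine ⟨((a + (4 + M) : ℕ) : ℝ) / q, by positivity, ?_⟩
  intro V _ _ G w P batch Opt R hw hgood hbatch hOpt hR
  set p : CorrClust.Params := ⟨ε, γ, W, η, s, κ, R⟩ with hp
  set n := Fintype.card V
  have hn0 : 0 < n := Fintype.card_pos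
  have hnR : (0 : ℝ) < n := by exact_mod_cast hn0
  set x : ENNReal := 1 - ENNReal.ofReal (q / n) with hx
  obtain ⟨Inv, μ, hrank, hinit, hbad, hμ⟩ : ∃ (Inv : CorrClust.Clustering V → Prop)
      (μ : CorrClust.Clustering V → ℕ), CorrClust.IsRank G w P p batch Inv μ ∧ Inv P.initial ∧
      (∀ 𝒞, Inv 𝒞 → ¬ P.IsGoodLocalOpt G w (3 / 2 * γ) (P.split ε Opt) 𝒞 →
        CorrClust.round G w P p batch 𝒞 𝒞 ≤ x) ∧
      (μ P.initial : ℝ) ≤ (n + 1) * (W * (n : ℝ) ^ 3 / γ) + n := by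
    rcases Nat.eq_zero_or_pos P.numAdm with hP | hP
    · refine ⟨_, _, CorrClust.isRank_of_numAdm_eq_zero hw hW hA hgood hP, rfl, ?_, ?_⟩
      · rintro 𝒞 rfl h
        exact absurd (CorrClust.isGoodLocalOpt_initial hε hε1 hP hOpt) h
      · simp only [Nat.cast_zero]
        positivity
    · refine ⟨_, _, CorrClust.isRank_costRank (p := p) hw hγ hP, trivial, ?_,
        CorrClust.costRank_le (p := p) hw hW hγ hP _⟩
      intro 𝒞 _ h
      exact CorrClust.round_apply_self_le (p := p) hw hW hε hε1 hA hγ hgood hη2 hηγ hbatch hs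
        ((le_max_left _ _).trans hpow) ((le_max_right _ _).trans hpow) hP hOpt h
  refine ⟨μ P.initial * (R + 1) + R + 1, CorrClust.halts hrank hinit, ?_⟩
  have hmain := CorrClust.le_toOuterMeasure_not_bad
    (Bad := fun 𝒞 => ¬ P.IsGoodLocalOpt G w (3 / 2 * γ) (P.split ε Opt) 𝒞) hrank hbad hinit
    (CorrClust.halts hrank hinit)
  simp only [not_not] at hmain
  refine le_trans ?_ hmain
  -- For `n = 1` the lower bound on `R` is void because `log 1 = 0`, but the claimed probability `1
  -- - 1/1^a` is `0`.
  rcases Nat.lt_or_ge n 2 with hn | hn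
  · have : n = 1 := by omega
    rw [this]
    simp
  have hqn : q ≤ n := (min_le_left _ _).trans (by exact_mod_cast hn0)
  have hxR : x ^ R = ENNReal.ofReal ((1 - q / n) ^ R) := by
    rw [ENNReal.ofReal_pow (by rw [sub_nonneg, div_le_one hnR]; exact hqn),
      ENNReal.ofReal_sub _ (by positivity), ENNReal.ofReal_one]
  have hpowR := CorrClust.one_sub_div_pow_le hn0 hq0 hqn hR
  have hrk := CorrClust.rank_bound_le hn hW hγ hM.le
  have herr : (1 + (μ P.initial : ENNReal)) * x ^ p.R ≤ ENNReal.ofReal (1 / (n : ℝ) ^ a) := by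
    have h1 : (1 + (μ P.initial : ENNReal)) = ENNReal.ofReal (1 + μ P.initial) := by
      rw [ENNReal.ofReal_add zero_le_one (by positivity), ENNReal.ofReal_one,
        ENNReal.ofReal_natCast]
    rw [h1, hxR, ← ENNReal.ofReal_mul (by positivity)]
    refine ENNReal.ofReal_le_ofReal ?_
    calc (1 + (μ P.initial : ℝ)) * (1 - q / n) ^ R
        ≤ (n : ℝ) ^ (4 + M) * ((n : ℝ) ^ (a + (4 + M)))⁻¹ :=
          mul_le_mul (by linarith) hpowR
            (pow_nonneg (by rw [sub_nonneg, div_le_one hnR]; exact hqn) _) (by positivity)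
      _ = _ := by
          rw [pow_add (n : ℝ) a]
          field_simp
  rw [ENNReal.ofReal_sub _ (by positivity), ENNReal.ofReal_one]
  exact tsub_le_tsub_left herr 1
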